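/- Let $V$ be a $3$-dimensional complex vector space with a Hermitian form $\langle-,-\rangle$ (linear in the first variable) of signature $++-$, and let $\mathrm{SU}(2,1)$ be the group of linear automorphisms of $V$ of determinant $1$ that preserve the form. The signature $\sigma p\in\{-1,0,1\}$ of a point $p\in\mathbb PV$ is the sign of $\langle p,p\rangle$; $p$ is isotropic if $\sigma p=0$. For nonisotropic $p$ and $\alpha\in\mathbb C$, $|\alpha|=1$, put $$R_\alpha^p:x\mapsto(\alpha^{-2}-\alpha)\frac{\langle x,p\rangle}{\langle p,p\rangle}p+\alpha x .$$ An isometry is loxodromic (parabolic) if it has exactly two (exactly one) isotropic fixed points in $\mathbb PV$, and elliptic if it has a negative fixed point. Let $\boldsymbol\alpha=(\alpha_1,\alpha_2,\alpha_3)$ with $|\alpha_i|=1$, $\alpha_i^3\ne1$, let $\boldsymbol\sigma=(\sigma_1,\sigma_2,\sigma_3)$ with $\sigma_i\in\{-1,1\}$, at most one of them positive, and let $\tau\in\mathbb C$. A triple $p_1,p_2,p_3$ of nonisotropic points of $\mathbb PV$ is strongly regular with respect to $\boldsymbol\alpha,\boldsymbol\sigma,\tau$ if $\sigma p_i=\sigma_i$;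 the $p_i$ are pairwise distinct; $p_2$ is orthogonal neither to $p_1$ nor to $p_3$; $p_1,p_2,p_3$ do not lie in a same complex line; and $\operatorname{tr}R_{\alpha_3}^{p_3}R_{\alpha_2}^{p_2}R_{\alpha_1}^{p_1}=\tau$. For such a triple and $i\in\{1,2\}$ let $R=R_{\alpha_{i+1}}^{p_{i+1}}R_{\alpha_i}^{p_i}$, let $L=\mathbb Cp_i+\mathbb Cp_{i+1}$, and let $c$ span $L^\perp$. The bendings of $R$ are the elements $B(s)$, $s\in\mathbb R$, of the one-parameter subgroup $B:\mathbb R\to\mathrm{SU}(2,1)$ with $B(s)c=c$ that is given on $L$ as follows: if $R$ is elliptic, $B(s)v=e^{is/2}v$ and $B(s)w=e^{-is/2}w$, where $v,w\in L$ are orthogonal nonisotropic eigenvectors of $R$; if $R$ is loxodromic, $B(s)v_1=e^sv_1$ and $B(s)v_2=e^{-s}v_2$, where $v_1,v_2\in L$ are linearly independent isotropic eigenvectors of $R$; if $R$ is parabolic, $B(s)v_1=v_1$ and $B(s)v_2=is\,v_1+v_2$, where $v_1\in L$ is an isotropic eigenvector of $R$ and $v_2\in L$ is isotropic, linearly independent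 of $v_1$, with $\langle v_1,v_2\rangle\in\mathbb R$. Bending the triple at $p_i,p_{i+1}$ means replacing $p_i,p_{i+1}$ by $B(s)p_i,B(s)p_{i+1}$ for some $s\in\mathbb R$ and keeping the third point. Let $p_1,p_2,p_3$ and $q_1,q_2,q_3$ be strongly regular triples with respect to the same $\boldsymbol\alpha,\boldsymbol\sigma,\tau$. Assume that $R_{\alpha_3}^{p_3}R_{\alpha_2}^{p_2}R_{\alpha_1}^{p_1}$ and $R_{\alpha_3}^{q_3}R_{\alpha_2}^{q_2}R_{\alpha_1}^{q_1}$ are conjugate in $\mathrm{SU}(2,1)$, that at least one of $R_{\alpha_3}^{p_3}R_{\alpha_2}^{p_2}$, $R_{\alpha_2}^{p_2}R_{\alpha_1}^{p_1}$ is loxodromic, and that at least one of $R_{\alpha_3}^{q_3}R_{\alpha_2}^{q_2}$, $R_{\alpha_2}^{q_2}R_{\alpha_1}^{q_1}$ is loxodromic. Then there are a finite sequence of strongly regular triples with respect to $\boldsymbol\alpha,\boldsymbol\sigma,\tau$ that starts at $p_1,p_2,p_3$, in which every triple arises from the preceding one by a bending at its first two or at its last two points, and an element $g\in\mathrm{SU}(2,1)$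 such that the last triple of the sequence is $gq_1,gq_2,gq_3$. -/

import Mathlib

namespace ComplexHyperbolic

open Module
open scoped LinearAlgebra.Projectivization

variable {V : Type*} [AddCommGroup V] [Module ℂ V]

/-- Sesquilinear forms on `V`, linear in the first and conjugate-linear in the second variable:
`h x y` is `⟨x, y⟩`. -/
abbrev SesqForm (V : Type*) [AddCommGroup V] [Module ℂ V] : Type _ := V →ₗ[ℂ] V →ₗ⋆[ℂ] ℂ

/-- `h` is a Hermitian form of signature `++-` on a three-dimensional complex space. -/
def IsHermitianSig21 (h : SesqForm V) : Prop :=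
  (∀ x y, h x y = star (h y x)) ∧
    ∃ b : Basis (Fin 3) ℂ V,
      (∀ i j, i ≠ j → h (b i) (b j) = 0) ∧
        h (b 0) (b 0) = 1 ∧ h (b 1) (b 1) = 1 ∧ h (b 2) (b 2) = -1

/-- The group `SU(2,1)` of the form `h`: linear automorphisms that preserve `h` and have
determinant `1`. It acts on `V` and on the projective plane `ℙ ℂ V`. -/
def SU (h : SesqForm V) : Subgroup (V ≃ₗ[ℂ] V) where
  carrier := {g | (∀ v w, h (g v) (g w) = h v w) ∧ LinearEquiv.det g = 1}
  mul_mem' := by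
    rintro a b ⟨ha, ha'⟩ ⟨hb, hb'⟩
    exact ⟨fun v w => by simp [ha, hb], by simp [ha', hb']⟩
  one_mem' := ⟨fun v w => by simp, by simp⟩
  inv_mem' := by
    rintro a ⟨ha, ha'⟩
    refine ⟨fun v w => ?_, by simp [ha']⟩
    have := ha (a⁻¹ v) (a⁻¹ w)
    simp at this
    exact this.symm

/-- The signature `-1`, `0`, `1` of a point: negative, isotropic, positive. -/
noncomputable def signature (h : SesqForm V) (p : ℙ ℂ V) : SignType :=
  SignType.sign (h p.rep p.rep).re

/-- Orthogonality of two points. -/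
def Orthogonal (h : SesqForm V) (p q : ℙ ℂ V) : Prop := h p.rep q.rep = 0

/-- The map `R_α^p : x ↦ (α⁻² - α) (⟨x, p⟩ / ⟨p, p⟩) p + α x` with centre `p` and parameter `α`. -/
noncomputable def specialElliptic (h : SesqForm V) (α : ℂ) (p : ℙ ℂ V) : End ℂ V :=
  (((α ^ 2)⁻¹ - α) / h p.rep p.rep) • (h.flip p.rep).smulRight p.rep + α • LinearMap.id

theorem specialElliptic_apply (h : SesqForm V) (α : ℂ) (p : ℙ ℂ V) (x : V) :
    specialElliptic h α p x =
      (((α ^ 2)⁻¹ - α) * (h x p.rep / h p.rep p.rep)) • p.rep + α • x := by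
  simp [specialElliptic, smul_smul, div_mul_eq_mul_div, mul_div_assoc]

/-- `R_α^p` does not depend on the chosen representative of `p`. -/
theorem specialElliptic_mk_apply (h : SesqForm V) (α : ℂ) (v : V) (hv : v ≠ 0) (x : V) :
    specialElliptic h α (Projectivization.mk ℂ v hv) x =
      (((α ^ 2)⁻¹ - α) * (h x v / h v v)) • v + α • x := by
  obtain ⟨a, ha⟩ := Projectivization.exists_smul_eq_mk_rep ℂ v hv
  have ha0 : (a : ℂ) ≠ 0 := a.ne_zero
  rw [specialElliptic_apply, ← ha]
  simp only [Units.smul_def, map_smul, map_smulₛₗ, LinearMap.smul_apply, smul_eq_mul, smul_smul]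
  have hs : (starRingEnd ℂ) (a : ℂ) ≠ 0 := by simp
  congr 2
  by_cases hvv : h v v = 0
  · simp [hvv]
  · field_simp

/-- A fixed point of a linear map is the class of an eigenvector. -/
def IsFixedPoint (T : End ℂ V) (x : ℙ ℂ V) : Prop := ∃ μ : ℂ, T.HasEigenvector μ x.rep

/-- The isometry `T` has a negative fixed point. -/
def IsElliptic (h : SesqForm V) (T : End ℂ V) : Prop :=
  ∃ x : ℙ ℂ V, signature h x = -1 ∧ IsFixedPoint T x

/-- The isometry `T` has exactly one isotropic fixed point. -/
def IsParabolic (h : SesqForm V) (T : End ℂ V) : Prop :=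
  {x : ℙ ℂ V | signature h x = 0 ∧ IsFixedPoint T x}.encard = 1

/-- The isometry `T` has exactly two isotropic fixed points. -/
def IsLoxodromic (h : SesqForm V) (T : End ℂ V) : Prop :=
  {x : ℙ ℂ V | signature h x = 0 ∧ IsFixedPoint T x}.encard = 2

/-- Two linear maps are conjugate by an element of `SU(2,1)`. -/
def SUConj (h : SesqForm V) (S T : End ℂ V) : Prop :=
  ∃ g : SU h, ∀ x : V, T (g • x) = g • S x

/-- `R_{α₂}^{p₂} R_{α₁}^{p₁}` for consecutive points of a triple (indexed by `0, 1, 2`). -/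
noncomputable def pairProduct (h : SesqForm V) (α : Fin 3 → ℂ) (p : Fin 3 → ℙ ℂ V)
    (i j : Fin 3) : End ℂ V :=
  specialElliptic h (α j) (p j) * specialElliptic h (α i) (p i)

/-- `R_{α₃}^{p₃} R_{α₂}^{p₂} R_{α₁}^{p₁}`. -/
noncomputable def tripleProduct (h : SesqForm V) (α : Fin 3 → ℂ) (p : Fin 3 → ℙ ℂ V) : End ℂ V :=
  specialElliptic h (α 2) (p 2) * specialElliptic h (α 1) (p 1) * specialElliptic h (α 0) (p 0)

/-- The triple `p` is strongly regular with respect to the parameters `α`, the signs `σ` and the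
trace `τ`. -/
structure StronglyRegular (h : SesqForm V) (α : Fin 3 → ℂ) (σ : Fin 3 → SignType) (τ : ℂ)
    (p : Fin 3 → ℙ ℂ V) : Prop where
  norm_param : ∀ i, ‖α i‖ = 1
  param_cube : ∀ i, α i ^ 3 ≠ 1
  sign_ne_zero : ∀ i, σ i ≠ 0
  at_most_one_positive : ∀ i j, σ i = 1 → σ j = 1 → i = j
  signature_eq : ∀ i, signature h (p i) = σ i
  distinct : Function.Injective p
  not_orthogonal_left : ¬ Orthogonal h (p 1) (p 0)
  not_orthogonal_right : ¬ Orthogonal h (p 1) (p 2)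
  not_collinear : ¬ ∃ W : Submodule ℂ V, finrank ℂ W = 2 ∧ ∀ i, (p i).submodule ≤ W
  trace_eq : LinearMap.trace ℂ V (tripleProduct h α p) = τ

/-- `B` is the one-parameter subgroup of bendings of `R`, where `R = R_{α₂}^{p₂} R_{α₁}^{p₁}` and the
two-dimensional subspace `L` is the complex line through `p₁` and `p₂`. In all three cases `c` spans
the orthogonal complement of `L` and is fixed by `B s`; on `L`, the map `B s` is
`diag (e^{is/2}, e^{-is/2})` in an orthogonal basis of eigenvectors of `R` if `R` is elliptic,
`diag (e^s, e^{-s})` in a basis of isotropic eigenvectors of `R` if `R` is loxodromic, and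
`v₁ ↦ v₁`, `v₂ ↦ i s v₁ + v₂` if `R` is parabolic, with `v₁` an isotropic eigenvector of `R` and
`v₂` isotropic with `⟨v₁, v₂⟩` real. -/
def IsBendingGroup (h : SesqForm V) (R : End ℂ V) (L : Submodule ℂ V) (B : ℝ → SU h) : Prop :=
  (IsElliptic h R ∧ ∃ c v w : V,
    c ≠ 0 ∧ (∀ x ∈ L, h x c = 0) ∧
    v ∈ L ∧ w ∈ L ∧ h v v ≠ 0 ∧ h w w ≠ 0 ∧ h v w = 0 ∧
    (∃ μ, R.HasEigenvector μ v) ∧ (∃ μ, R.HasEigenvector μ w) ∧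
    ∀ s : ℝ, B s • c = c ∧
      B s • v = Complex.exp ((s / 2 : ℝ) * Complex.I) • v ∧
      B s • w = Complex.exp (-(s / 2 : ℝ) * Complex.I) • w) ∨
  (IsLoxodromic h R ∧ ∃ c v₁ v₂ : V,
    c ≠ 0 ∧ (∀ x ∈ L, h x c = 0) ∧
    v₁ ∈ L ∧ v₂ ∈ L ∧ h v₁ v₁ = 0 ∧ h v₂ v₂ = 0 ∧ LinearIndependent ℂ ![v₁, v₂] ∧
    (∃ μ, R.HasEigenvector μ v₁) ∧ (∃ μ, R.HasEigenvector μ v₂) ∧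
    ∀ s : ℝ, B s • c = c ∧
      B s • v₁ = (Real.exp s : ℂ) • v₁ ∧
      B s • v₂ = (Real.exp (-s) : ℂ) • v₂) ∨
  (IsParabolic h R ∧ ∃ c v₁ v₂ : V,
    c ≠ 0 ∧ (∀ x ∈ L, h x c = 0) ∧
    v₁ ∈ L ∧ v₂ ∈ L ∧ h v₁ v₁ = 0 ∧ h v₂ v₂ = 0 ∧ (h v₁ v₂).im = 0 ∧
    LinearIndependent ℂ ![v₁, v₂] ∧
    (∃ μ, R.HasEigenvector μ v₁) ∧
    ∀ s : ℝ, B s • c = c ∧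
      B s • v₁ = v₁ ∧
      B s • v₂ = ((s : ℂ) * Complex.I) • v₁ + v₂)

/-- `q` arises from `p` by a bending that involves the points `p i`, `p j`: these are moved by
`B s`, and the remaining point stays. -/
def BendsAt (h : SesqForm V) (α : Fin 3 → ℂ) (i j : Fin 3) (p q : Fin 3 → ℙ ℂ V) : Prop :=
  ∃ (B : ℝ → SU h) (s : ℝ),
    IsBendingGroup h (pairProduct h α p i j) ((p i).submodule ⊔ (p j).submodule) B ∧
      q i = B s • p i ∧ q j = B s • p j ∧ ∀ k, k ≠ i → k ≠ j → q k = p k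

/-- A single bending, of the first two or of the last two points, between triples that are strongly
regular with respect to the same data. -/
def BendingStep (h : SesqForm V) (α : Fin 3 → ℂ) (σ : Fin 3 → SignType) (τ : ℂ)
    (p q : Fin 3 → ℙ ℂ V) : Prop :=
  StronglyRegular h α σ τ p ∧ StronglyRegular h α σ τ q ∧
    (BendsAt h α 0 1 p q ∨ BendsAt h α 1 2 p q)

end ComplexHyperbolic

open ComplexHyperbolic

/-! Up to an element of `SU h`, bending two consecutive points `p i`, `p j` is the same as keeping
them and applying the inverse bending to the third point `p k`. Such a `Move`, restricted to
loxodromic pairs, is reversible and commutes with translations, so it suffices to join both triples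
to a common one by moves and translations (`exists_bendingSteps`).

Two facts let the moves reach a common pair. A move by a loxodromic pair takes the tance of `p 1`
and `p k` to any value of the same sign and at least the same absolute value
(`IsWittFrame.exists_bend_tance`). Conversely, a pair whose tance is large in absolute value has a
loxodromic product, because the trace on its line then has modulus above `2`
(`exists_pairFrame_of_tance`). So one loxodromic pair is enough to make the other loxodromic as
well, and the tance of either pair can be raised to a prescribed large value
(`StronglyRegular.exists_tance_eq`). Once both triples have the same large tance at `i`, `j`, a
translation makes these pairs equal (`exists_SU_of_tance_eq`).

It remains to compare third points over a fixed loxodromic pair with product `R`. Since `α k ^ 3 ≠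
1`, the trace `τ` determines `⟨R x, x⟩ / ⟨x, x⟩` for `x` representing the third point. For negative
`x` this fixes the orbit of the point under the isometries diagonal in the frame of `R`
(`IsLoxFrame.exists_diagMap_eq`), and that orbit is swept out by bendings and by rotations that fix
the pair. At most one sign is positive, so one of the two outer points is negative and can serve as
the third point. -/

namespace ComplexHyperbolic

open Module
open scoped LinearAlgebra.Projectivization ComplexConjugate

variable {V : Type*} [AddCommGroup V] [Module ℂ V]

/-! ### Hermitian forms of signature `++-`. -/

section Form

variable {h : SesqForm V}

theorem apply_smul_left (a : ℂ) (x y : V) : h (a • x) y = a * h x y := by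
  rw [map_smul h, LinearMap.smul_apply, smul_eq_mul]

theorem apply_smul_right (a : ℂ) (x y : V) : h x (a • y) = conj a * h x y := by
  rw [map_smulₛₗ, smul_eq_mul]

theorem IsHermitianSig21.conj_apply (hh : IsHermitianSig21 h) (x y : V) :
    conj (h x y) = h y x := (hh.1 y x).symm

theorem IsHermitianSig21.finrank_eq (hh : IsHermitianSig21 h) : finrank ℂ V = 3 := by
  obtain ⟨-, b, -⟩ := hh
  simpa using finrank_eq_card_basis b

theorem IsHermitianSig21.finiteDimensional (hh : IsHermitianSig21 h) : FiniteDimensional ℂ V := by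
  obtain ⟨-, b, -⟩ := hh
  exact Module.Finite.of_basis b

theorem IsHermitianSig21.self_im (hh : IsHermitianSig21 h) (x : V) : (h x x).im = 0 :=
  Complex.conj_eq_iff_im.1 (hh.conj_apply x x)

theorem IsHermitianSig21.ofReal_re (hh : IsHermitianSig21 h) (x : V) :
    (((h x x).re : ℝ) : ℂ) = h x x :=
  Complex.ext rfl (hh.self_im x).symm

theorem IsHermitianSig21.apply_eq_zero_symm (hh : IsHermitianSig21 h) {x y : V} (hxy : h x y = 0) :
    h y x = 0 := by
  rw [← hh.conj_apply, hxy, map_zero]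

/-- The plane spanned by the first two vectors of an orthogonal basis is a positive complement to
the kernel of the last coordinate. -/
theorem IsHermitianSig21.exists_coord (hh : IsHermitianSig21 h) :
    ∃ f : V →ₗ[ℂ] ℂ, ∀ x, f x = 0 → 0 ≤ (h x x).re ∧ (h x x = 0 → x = 0) := by
  obtain ⟨-, b, horth, h0, h1, h2⟩ := hh
  refine ⟨b.coord 2, fun x hx => ?_⟩
  have hx2 : b.repr x 2 = 0 := hx
  have hsum : x = b.repr x 0 • b 0 + b.repr x 1 • b 1 := by
    conv_lhs => rw [← b.sum_repr x]
    rw [Fin.sum_univ_three, hx2, zero_smul, add_zero]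
  have hval : h x x = ((‖b.repr x 0‖ ^ 2 + ‖b.repr x 1‖ ^ 2 : ℝ) : ℂ) := by
    rw [hsum]
    simp only [map_add, map_smul, map_smulₛₗ, LinearMap.add_apply, LinearMap.smul_apply, h0, h1,
      horth 0 1 (by decide), horth 1 0 (by decide), smul_eq_mul]
    simp [← Complex.mul_conj', mul_comm]
  refine ⟨?_, fun h0 => ?_⟩
  · rw [hval, Complex.ofReal_re]; positivity
  · rw [hval, Complex.ofReal_eq_zero] at h0
    have e0 : b.repr x 0 = 0 := norm_eq_zero.1 (by
      nlinarith [sq_nonneg ‖b.repr x 0‖, sq_nonneg ‖b.repr x 1‖])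
    have e1 : b.repr x 1 = 0 := norm_eq_zero.1 (by
      nlinarith [sq_nonneg ‖b.repr x 0‖, sq_nonneg ‖b.repr x 1‖])
    rw [hsum, e0, e1, zero_smul, zero_smul, add_zero]

theorem IsHermitianSig21.pos_of_orthogonal_neg (hh : IsHermitianSig21 h) {n c : V}
    (hn : (h n n).re < 0) (hcn : h c n = 0) (hc : c ≠ 0) : 0 < (h c c).re := by
  obtain ⟨f, hf⟩ := hh.exists_coord
  have hfn : f n ≠ 0 := fun h0 => absurd (hf n h0).1 (not_le.2 hn)
  -- This combination is killed by `f`, on whose kernel the form is positive definite, so `|f c|²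
  -- ⟨n, n⟩ + |f n|² ⟨c, c⟩ ≥ 0`.
  set x := f c • n - f n • c with hx
  have hfx : f x = 0 := by simp [hx, mul_comm]
  have hxx : h x x = ((‖f c‖ ^ 2 * (h n n).re + ‖f n‖ ^ 2 * (h c c).re : ℝ) : ℂ) := by
    rw [hx]
    push_cast
    rw [hh.ofReal_re, hh.ofReal_re, ← Complex.mul_conj', ← Complex.mul_conj']
    simp only [map_sub, map_smul, map_smulₛₗ, LinearMap.sub_apply, LinearMap.smul_apply, hcn,
      hh.apply_eq_zero_symm hcn, smul_eq_mul]
    ring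
  obtain ⟨hge, hz⟩ := hf x hfx
  rw [hxx, Complex.ofReal_re] at hge
  have hfn2 : 0 < ‖f n‖ ^ 2 := by positivity
  by_cases hfc : f c = 0
  · obtain ⟨hge', hz'⟩ := hf c hfc
    refine lt_of_le_of_ne hge' fun h0 => hc (hz' ?_)
    rw [← hh.ofReal_re, ← h0, Complex.ofReal_zero]
  · have : 0 < ‖f c‖ ^ 2 := by positivity
    by_contra hle
    push Not at hle
    nlinarith [mul_pos this (neg_pos.2 hn), mul_nonneg hfn2.le (neg_nonneg.2 hle)]

/-- Otherwise the span is a totally isotropic plane, which must meet the kernel of `f` although the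
form is definite there. -/
theorem IsHermitianSig21.apply_ne_zero_of_isotropic (hh : IsHermitianSig21 h) {a b : V}
    (ha : h a a = 0) (hb : h b b = 0) (hab : LinearIndependent ℂ ![a, b]) : h a b ≠ 0 := by
  intro h0
  obtain ⟨f, hf⟩ := hh.exists_coord
  have hz : f b • a + (-f a) • b = 0 := by
    refine (hf _ (by simp [mul_comm])).2 ?_
    simp [ha, hb, h0, hh.apply_eq_zero_symm h0]
  obtain ⟨hfb, hfa⟩ := LinearIndependent.pair_iff.1 hab _ _ hz
  have : a = 0 := (hf a (by simpa using hfa)).2 ha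
  exact hab.ne_zero 0 this

theorem IsHermitianSig21.exists_orthogonal (hh : IsHermitianSig21 h) (a b : V) :
    ∃ c, c ≠ 0 ∧ h c a = 0 ∧ h c b = 0 := by
  have := hh.finiteDimensional
  let f : V →ₗ[ℂ] ℂ × ℂ := (h.flip a).prod (h.flip b)
  have hker : f.ker ≠ ⊥ := LinearMap.ker_ne_bot_of_finrank_lt (by
    rw [hh.finrank_eq]; simp)
  obtain ⟨c, hc, hc0⟩ := Submodule.exists_mem_ne_zero_of_ne_bot hker
  have hfc : f c = 0 := hc
  exact ⟨c, hc0, congrArg Prod.fst hfc, congrArg Prod.snd hfc⟩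

end Form

/-- `v`, `w` span a hyperbolic plane, and `c` is a unit vector orthogonal to it. -/
structure IsWittFrame (h : SesqForm V) (c v w : V) : Prop where
  cc : h c c = 1
  vv : h v v = 0
  ww : h w w = 0
  vw : h v w = 1
  wv : h w v = 1
  cv : h c v = 0
  vc : h v c = 0
  cw : h c w = 0
  wc : h w c = 0

/-! ### Witt frames and the maps diagonal in them. -/

section Frame

variable {h : SesqForm V}

/-- After rescaling `b` so that `⟨a, b⟩ = 1`, the vector `a - b` has square `-2`. Hence `c`, being
orthogonal to it, is positive and can be normalized. -/
theorem IsHermitianSig21.exists_wittFrame (hh : IsHermitianSig21 h) {a b c : V}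
    (ha : h a a = 0) (hb : h b b = 0) (hab : h a b ≠ 0) (hc : c ≠ 0) (hca : h c a = 0)
    (hcb : h c b = 0) : ∃ r t : ℂ, r ≠ 0 ∧ t ≠ 0 ∧ IsWittFrame h (r • c) a (t • b) := by
  obtain ⟨t, ht⟩ : ∃ t : ℂ, t = conj (h a b)⁻¹ := ⟨_, rfl⟩
  have ht0 : t ≠ 0 := by simpa [ht] using hab
  have haw : h a (t • b) = 1 := by simp [ht, hab]
  have hwa : h (t • b) a = 1 := by rw [← hh.conj_apply, haw, map_one]
  have hww : h (t • b) (t • b) = 0 := by simp [hb]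
  have hcw : h c (t • b) = 0 := by simp [hcb]
  have hpos : 0 < (h c c).re := by
    refine hh.pos_of_orthogonal_neg (n := a - t • b) ?_ ?_ hc
    · have : h (a - t • b) (a - t • b) = -2 := by
        rw [map_sub, map_sub, LinearMap.sub_apply, LinearMap.sub_apply, haw, hwa, ha, hww]
        norm_num
      rw [this]; norm_num
    · rw [map_sub, hca, hcw, sub_zero]
  obtain ⟨ρ, hρ⟩ : ∃ ρ : ℝ, ρ = (Real.sqrt (h c c).re)⁻¹ := ⟨_, rfl⟩
  have h0 := Real.sqrt_pos.2 hpos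
  have hρ0 : ρ ≠ 0 := by rw [hρ]; positivity
  have hρρ : (ρ : ℂ) * (ρ * h c c) = 1 := by
    rw [hρ, ← hh.ofReal_re c]
    norm_cast
    have := Real.mul_self_sqrt hpos.le
    field_simp
    nlinarith
  have hac := hh.apply_eq_zero_symm hca
  have hwc := hh.apply_eq_zero_symm hcw
  have hr0 : (ρ : ℂ) ≠ 0 := by exact_mod_cast hρ0
  have hrc : conj (ρ : ℂ) = ρ := Complex.conj_ofReal ρ
  generalize (ρ : ℂ) = r at *
  refine ⟨r, t, hr0, ht0, ?_, ha, hww, haw, hwa, ?_, ?_, ?_, ?_⟩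
  · rw [apply_smul_left, apply_smul_right, hrc, hρρ]
  · rw [apply_smul_left, hca, mul_zero]
  · rw [map_smulₛₗ, hac, smul_zero]
  · rw [apply_smul_left, hcw, mul_zero]
  · rw [map_smulₛₗ, hwc, smul_zero]

theorem IsWittFrame.linearIndependent {c v w : V} (F : IsWittFrame h c v w) :
    LinearIndependent ℂ ![c, v, w] := by
  rw [Fintype.linearIndependent_iff]
  intro g hg
  simp only [Fin.sum_univ_three, Matrix.cons_val] at hg
  have e0 := congrArg (fun x => h x c) hg
  have e1 := congrArg (fun x => h x w) hg
  have e2 := congrArg (fun x => h x v) hg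
  simp [F.cc, F.vv, F.ww, F.vw, F.wv, F.cv, F.vc, F.cw, F.wc] at e0 e1 e2
  intro i
  fin_cases i <;> simp [e0, e1, e2]

/-- The basis given by a Witt frame. -/
noncomputable def IsWittFrame.basis {c v w : V} (F : IsWittFrame h c v w)
    (hV : finrank ℂ V = 3) : Basis (Fin 3) ℂ V :=
  basisOfLinearIndependentOfCardEqFinrank F.linearIndependent (by simp [hV])

theorem IsWittFrame.coe_basis {c v w : V} (F : IsWittFrame h c v w) (hV : finrank ℂ V = 3) :
    ⇑(F.basis hV) = ![c, v, w] := by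
  simp [IsWittFrame.basis]

theorem IsWittFrame.expand {c v w : V} (F : IsWittFrame h c v w) (hV : finrank ℂ V = 3) (x : V) :
    x = h x c • c + h x w • v + h x v • w := by
  have hx := (F.basis hV).sum_repr x
  simp only [Fin.sum_univ_three, F.coe_basis, Matrix.cons_val] at hx
  rw [← hx]
  simp [F.cc, F.vv, F.ww, F.vw, F.wv, F.cv, F.vc, F.cw, F.wc]

theorem IsWittFrame.apply_eq {c v w : V} (F : IsWittFrame h c v w) (hV : finrank ℂ V = 3)
    (x y : V) :
    h x y = h x c * conj (h y c) + h x w * conj (h y v) + h x v * conj (h y w) := by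
  conv_lhs => rw [F.expand hV y]
  simp only [map_add, map_smulₛₗ, smul_eq_mul]
  ring

/-- The linear map that is diagonal in a Witt frame. -/
noncomputable def diagMap (h : SesqForm V) (c v w : V) (a b d : ℂ) : End ℂ V :=
  a • (h.flip c).smulRight c + b • (h.flip w).smulRight v + d • (h.flip v).smulRight w

theorem diagMap_apply (c v w : V) (a b d : ℂ) (x : V) :
    diagMap h c v w a b d x = (a * h x c) • c + (b * h x w) • v + (d * h x v) • w := by
  simp [diagMap, smul_smul]

theorem IsWittFrame.diagMap_coord_c {c v w : V} (F : IsWittFrame h c v w) (a b d : ℂ) (x : V) :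
    h (diagMap h c v w a b d x) c = a * h x c := by
  simp [diagMap_apply, F.cc, F.vc, F.wc]

theorem IsWittFrame.diagMap_coord_v {c v w : V} (F : IsWittFrame h c v w) (a b d : ℂ) (x : V) :
    h (diagMap h c v w a b d x) v = d * h x v := by
  simp [diagMap_apply, F.cv, F.vv, F.wv]

theorem IsWittFrame.diagMap_coord_w {c v w : V} (F : IsWittFrame h c v w) (a b d : ℂ) (x : V) :
    h (diagMap h c v w a b d x) w = b * h x w := by
  simp [diagMap_apply, F.cw, F.vw, F.ww]

theorem IsWittFrame.diagMap_diagMap {c v w : V} (F : IsWittFrame h c v w) (a b d a' b' d' : ℂ)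
    (x : V) :
    diagMap h c v w a b d (diagMap h c v w a' b' d' x)
      = diagMap h c v w (a * a') (b * b') (d * d') x := by
  rw [diagMap_apply, F.diagMap_coord_c, F.diagMap_coord_v, F.diagMap_coord_w, diagMap_apply]
  simp only [mul_assoc]

theorem IsWittFrame.diagMap_one {c v w : V} (F : IsWittFrame h c v w) (hV : finrank ℂ V = 3)
    (x : V) : diagMap h c v w 1 1 1 x = x := by
  rw [diagMap_apply, one_mul, one_mul, one_mul, ← F.expand hV]

theorem IsWittFrame.diagMap_isometry {c v w : V} (F : IsWittFrame h c v w) (hV : finrank ℂ V = 3)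
    {a b d : ℂ} (ha : a * conj a = 1) (hbd : b * conj d = 1) (x y : V) :
    h (diagMap h c v w a b d x) (diagMap h c v w a b d y) = h x y := by
  have hdb : d * conj b = 1 := by simpa [mul_comm] using congrArg conj hbd
  rw [F.apply_eq hV, F.apply_eq hV x y]
  simp only [F.diagMap_coord_c, F.diagMap_coord_v, F.diagMap_coord_w, map_mul]
  linear_combination (h x c * conj (h y c)) * ha + (h x w * conj (h y v)) * hbd
    + (h x v * conj (h y w)) * hdb

theorem IsWittFrame.det_diagMap {c v w : V} (F : IsWittFrame h c v w) (hV : finrank ℂ V = 3)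
    (a b d : ℂ) : LinearMap.det (diagMap h c v w a b d) = a * b * d := by
  have : diagMap h c v w a b d
      = Matrix.toLin (F.basis hV) (F.basis hV) (Matrix.diagonal ![a, b, d]) := by
    refine (F.basis hV).ext fun i => ?_
    rw [Matrix.toLin_self]
    simp only [F.coe_basis, Fin.sum_univ_three, diagMap_apply]
    fin_cases i <;>
      simp [F.cc, F.vv, F.ww, F.vw, F.wv, F.cv, F.vc, F.cw, F.wc]
  rw [this, LinearMap.det_toLin, Matrix.det_diagonal]
  simp [Fin.prod_univ_three]

/-- The invertible diagonal map in a Witt frame. -/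
noncomputable def IsWittFrame.diagEquiv {c v w : V} (F : IsWittFrame h c v w)
    (hV : finrank ℂ V = 3) {a b d : ℂ} (ha : a ≠ 0) (hb : b ≠ 0) (hd : d ≠ 0) : V ≃ₗ[ℂ] V :=
  LinearEquiv.ofLinearMap (diagMap h c v w a b d) (diagMap h c v w a⁻¹ b⁻¹ d⁻¹)
    (LinearMap.ext fun x => by
      simp [F.diagMap_diagMap, ha, hb, hd, F.diagMap_one hV])
    (LinearMap.ext fun x => by
      simp [F.diagMap_diagMap, ha, hb, hd, F.diagMap_one hV])

/-- The hyperbolic one-parameter group of a Witt frame. -/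
noncomputable def IsWittFrame.bend {c v w : V} (F : IsWittFrame h c v w)
    (hV : finrank ℂ V = 3) (s : ℝ) : SU h :=
  ⟨F.diagEquiv hV one_ne_zero (Complex.exp_ne_zero (s : ℂ)) (Complex.exp_ne_zero (-s : ℂ)), by
    refine ⟨fun x y => F.diagMap_isometry hV (by simp) ?_ x y, ?_⟩
    · rw [← Complex.exp_conj, ← Complex.exp_add]; simp
    · refine Units.ext ?_
      rw [LinearEquiv.coe_det]
      refine (F.det_diagMap hV _ _ _).trans ?_
      rw [one_mul, ← Complex.exp_add]; simp⟩

theorem IsWittFrame.bend_smul {c v w : V} (F : IsWittFrame h c v w)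
    (hV : finrank ℂ V = 3) (s : ℝ) (x : V) :
    F.bend hV s • x = diagMap h c v w 1 (Complex.exp s) (Complex.exp (-s)) x := rfl

theorem IsWittFrame.bend_neg {c v w : V} (F : IsWittFrame h c v w)
    (hV : finrank ℂ V = 3) (s : ℝ) : F.bend hV (-s) = (F.bend hV s)⁻¹ := by
  rw [eq_inv_iff_mul_eq_one]
  refine Subtype.ext (LinearEquiv.ext fun x => ?_)
  change F.bend hV (-s) • F.bend hV s • x = x
  rw [F.bend_smul, F.bend_smul, F.diagMap_diagMap, ← Complex.exp_add, ← Complex.exp_add]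
  simp [F.diagMap_one hV]

end Frame

theorem exists_rep_mk_eq_smul (v : V) (hv : v ≠ 0) :
    ∃ a : ℂ, a ≠ 0 ∧ (Projectivization.mk ℂ v hv).rep = a • v := by
  obtain ⟨a, ha⟩ := Projectivization.exists_smul_eq_mk_rep ℂ v hv
  exact ⟨a, a.ne_zero, ha.symm⟩

theorem eq_of_rep_eq_smul {p q : ℙ ℂ V} {a : ℂ} (h : p.rep = a • q.rep) : p = q := by
  rw [← p.mk_rep, ← q.mk_rep, Projectivization.mk_eq_mk_iff']
  exact ⟨a, h.symm⟩

theorem exists_smul_rep_of_mk_eq {v : V} {hv : v ≠ 0} {p : ℙ ℂ V}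
    (h : Projectivization.mk ℂ v hv = p) : ∃ a : ℂ, v = a • p.rep := by
  obtain ⟨a, ha, hrep⟩ := exists_rep_mk_eq_smul v hv
  exact ⟨a⁻¹, by rw [← h, hrep, smul_smul, inv_mul_cancel₀ ha, one_smul]⟩

theorem linearIndependent_rep {p q : ℙ ℂ V} (hpq : p ≠ q) :
    LinearIndependent ℂ ![p.rep, q.rep] :=
  Projectivization.linearIndependent_pair_iff_ne.2 hpq

theorem mul_conj_eq_one {z : ℂ} (hz : ‖z‖ = 1) : z * conj z = 1 := by
  rw [Complex.mul_conj', hz]; norm_num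

theorem norm_eq_one_of_mul_conj {z : ℂ} (hz : z * conj z = 1) : ‖z‖ = 1 := by
  rw [Complex.mul_conj'] at hz
  have : ‖z‖ ^ 2 = 1 := by exact_mod_cast hz
  exact (pow_eq_one_iff_of_nonneg (norm_nonneg z) two_ne_zero).1 this

/-! ### Special elliptic isometries. -/

section SpecialElliptic

variable {h : SesqForm V}

theorem specialElliptic_rep {α : ℂ} {p : ℙ ℂ V} (hp : h p.rep p.rep ≠ 0) :
    specialElliptic h α p p.rep = (α ^ 2)⁻¹ • p.rep := by
  rw [specialElliptic_apply, div_self hp, mul_one, ← add_smul, sub_add_cancel]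

theorem specialElliptic_of_orthogonal {α : ℂ} {p : ℙ ℂ V} {x : V} (hx : h x p.rep = 0) :
    specialElliptic h α p x = α • x := by
  rw [specialElliptic_apply, hx, zero_div, mul_zero, zero_smul, zero_add]

theorem specialElliptic_isometry (hh : IsHermitianSig21 h) {α : ℂ} (hα : ‖α‖ = 1) {p : ℙ ℂ V}
    (hp : h p.rep p.rep ≠ 0) (x y : V) :
    h (specialElliptic h α p x) (specialElliptic h α p y) = h x y := by
  have h1 := mul_conj_eq_one hα
  have hα0 : α ≠ 0 := by rintro rfl; simp at hα
  have hc0 : conj α ≠ 0 := by simpa using hα0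
  have hN : conj (h p.rep p.rep) = h p.rep p.rep := hh.conj_apply _ _
  have h2 : (α ^ 2)⁻¹ * conj (α ^ 2)⁻¹ = 1 := by
    rw [map_inv₀, map_pow, ← mul_inv, ← mul_pow, h1, one_pow, inv_one]
  simp only [specialElliptic_apply, map_add, map_smul, map_smulₛₗ, LinearMap.add_apply,
    LinearMap.smul_apply, smul_eq_mul, map_mul, map_sub, map_div₀, hh.conj_apply]
  generalize (α ^ 2)⁻¹ = A at *
  generalize h p.rep p.rep = N at *
  generalize h x p.rep = s
  generalize h p.rep y = t
  generalize h x y = r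
  field_simp
  generalize conj α = a at *
  generalize conj A = B at *
  linear_combination (s * t) * h2 + (N * r - s * t) * h1

/-- `specialElliptic h α p` is `α` plus a map of rank one. With `R` fixed, the trace therefore
records exactly `⟨R p, p⟩ / ⟨p, p⟩`, provided that `α⁻² ≠ α`. -/
theorem trace_specialElliptic_mul (α : ℂ) (p : ℙ ℂ V) (R : End ℂ V) [FiniteDimensional ℂ V] :
    LinearMap.trace ℂ V (specialElliptic h α p * R)
      = ((α ^ 2)⁻¹ - α) / h p.rep p.rep * h (R p.rep) p.rep + α * LinearMap.trace ℂ V R := by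
  have : specialElliptic h α p * R
      = (((α ^ 2)⁻¹ - α) / h p.rep p.rep) • ((h.flip p.rep).comp R).smulRight p.rep + α • R := by
    ext x; simp [specialElliptic]
  rw [this, map_add, map_smul, map_smul, LinearMap.trace_smulRight]
  simp

end SpecialElliptic

/-- A Witt frame in which the isometry `R` is diagonal, with a loxodromic action on the
hyperbolic plane. -/
structure IsLoxFrame (h : SesqForm V) (R : End ℂ V) (c v w : V) (n l m : ℂ) : Prop
    extends IsWittFrame h c v w where
  eig_c : R c = n • c
  eig_v : R v = l • v
  eig_w : R w = m • w
  norm_n : ‖n‖ = 1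
  norm_l : ‖l‖ ≠ 1
  mul_conj : l * conj m = 1

/-! ### Loxodromic isometries and their frames. -/

section Lox

variable {h : SesqForm V} {R : End ℂ V}

theorem IsLoxFrame.norm_l_mul_norm_m {c v w : V} {n l m : ℂ} (F : IsLoxFrame h R c v w n l m) :
    ‖l‖ * ‖m‖ = 1 := by
  simpa using congrArg norm F.mul_conj

theorem IsLoxFrame.norm_m {c v w : V} {n l m : ℂ} (F : IsLoxFrame h R c v w n l m) :
    ‖m‖ ≠ 1 := fun hm => F.norm_l (by simpa [hm] using F.norm_l_mul_norm_m)

theorem IsLoxFrame.l_ne_m {c v w : V} {n l m : ℂ} (F : IsLoxFrame h R c v w n l m) :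
    l ≠ m := by
  rintro rfl
  exact F.norm_l (norm_eq_one_of_mul_conj F.mul_conj)

theorem mul_conj_eq_one_of_eigenvectors (hR : ∀ x y, h (R x) (R y) = h x y) {a b : V} {l m : ℂ}
    (hRa : R a = l • a) (hRb : R b = m • b) (hab : h a b ≠ 0) : l * conj m = 1 := by
  have := hR a b
  rw [hRa, hRb, apply_smul_left, apply_smul_right] at this
  exact mul_right_cancel₀ hab (by linear_combination this)

/-- Nonorthogonal eigenvectors of an isometry have eigenvalues with `l * conj m = 1`. So `c`, with a
unit eigenvalue, is orthogonal to both `a` and `b`, whose eigenvalues are not of modulus one. -/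
theorem IsHermitianSig21.exists_loxFrame_of_eigenvectors (hh : IsHermitianSig21 h)
    (hR : ∀ x y, h (R x) (R y) = h x y) {a b c : V} {n l m : ℂ} (hRa : R a = l • a)
    (hRb : R b = m • b) (hRc : R c = n • c) (hn : ‖n‖ = 1) (hl : ‖l‖ ≠ 1)
    (ha : h a a = 0) (hb : h b b = 0) (hab : h a b ≠ 0) (hc : c ≠ 0) :
    ∃ r t : ℂ, r ≠ 0 ∧ t ≠ 0 ∧ IsLoxFrame h R (r • c) a (t • b) n l m := by
  have hlm : l * conj m = 1 := mul_conj_eq_one_of_eigenvectors hR hRa hRb hab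
  have hnm : ‖l‖ * ‖m‖ = 1 := by simpa using congrArg norm hlm
  have hm : ‖m‖ ≠ 1 := fun hm => hl (by simpa [hm] using hnm)
  have horth : ∀ {x : V} {k : ℂ}, R x = k • x → ‖k‖ ≠ 1 → h c x = 0 := by
    intro x k hx hk
    by_contra h0
    have h1 : n * conj k = 1 := mul_conj_eq_one_of_eigenvectors hR hRc hx h0
    have h2 : ‖n‖ * ‖k‖ = 1 := by simpa using congrArg norm h1
    exact hk (by simpa [hn] using h2)
  obtain ⟨r, t, hr, ht, F⟩ := hh.exists_wittFrame ha hb hab hc (horth hRa hl) (horth hRb hm)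
  refine ⟨r, t, hr, ht, F, ?_, hRa, ?_, hn, hl, hlm⟩
  · rw [map_smul, hRc, smul_comm]
  · rw [map_smul, hRb, smul_comm]

theorem signature_eq_zero_iff (hh : IsHermitianSig21 h) (x : ℙ ℂ V) :
    signature h x = 0 ↔ h x.rep x.rep = 0 := by
  rw [signature, sign_eq_zero_iff, ← hh.ofReal_re, Complex.ofReal_eq_zero, Complex.ofReal_re]

theorem IsLoxFrame.isLoxodromic (hh : IsHermitianSig21 h) {c v w : V} {n l m : ℂ}
    (F : IsLoxFrame h R c v w n l m) : IsLoxodromic h R := by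
  have hV := hh.finrank_eq
  have hv0 : v ≠ 0 := by rintro rfl; simpa using F.vw
  have hw0 : w ≠ 0 := by rintro rfl; simpa using F.vw
  have key : {x : ℙ ℂ V | signature h x = 0 ∧ IsFixedPoint R x}
      = {Projectivization.mk ℂ v hv0, Projectivization.mk ℂ w hw0} := by
    ext x
    simp only [Set.mem_ofPred_eq, Set.mem_insert_iff, Set.mem_singleton_iff,
      signature_eq_zero_iff hh]
    constructor
    · rintro ⟨hx, k, hk⟩
      have hex := F.expand hV x.rep
      have hRx := hk.apply_eq_smul
      have hRe : R x.rep = (n * h x.rep c) • c + (l * h x.rep w) • v + (m * h x.rep v) • w := by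
        conv_lhs => rw [hex]
        simp only [map_add, map_smul, F.eig_c, F.eig_v, F.eig_w, smul_smul, mul_comm]
      rw [hRe] at hRx
      have ec := congrArg (fun y => h y c) hRx
      have ev := congrArg (fun y => h y v) hRx
      have ew := congrArg (fun y => h y w) hRx
      simp only [map_add, map_smul, LinearMap.add_apply, LinearMap.smul_apply, smul_eq_mul, F.cc,
        F.vv, F.ww, F.vw, F.wv, F.cv, F.vc, F.cw, F.wc, mul_zero, mul_one, add_zero,
        zero_add] at ec ev ew
      have hself := F.apply_eq hV x.rep x.rep
      rw [hx] at hself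
      -- Since `l ≠ m`, an eigenvector lacks its `v`- or its `w`-component. Then `⟨x, x⟩` reduces to
      -- `|⟨x, c⟩|²`, which vanishes by isotropy.
      have hcase : h x.rep c = 0 ∧ (h x.rep v = 0 ∨ h x.rep w = 0) := by
        have hln : l ≠ n := fun e => F.norm_l (e ▸ F.norm_n)
        have hmn : m ≠ n := fun e => F.norm_m (e ▸ F.norm_n)
        have hlm := F.l_ne_m
        have hvw : h x.rep v = 0 ∨ h x.rep w = 0 := by
          by_contra hne
          push Not at hne
          exact hlm ((mul_right_cancel₀ hne.2 ew).trans (mul_right_cancel₀ hne.1 ev).symm)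
        refine ⟨?_, hvw⟩
        have : h x.rep c * conj (h x.rep c) = 0 := by
          rcases hvw with h0 | h0 <;> rw [h0] at hself <;> simpa using hself.symm
        simpa using this
      obtain ⟨hc, hv | hw⟩ := hcase
      · left
        rw [← x.mk_rep, Projectivization.mk_eq_mk_iff']
        refine ⟨h x.rep w, ?_⟩
        conv_rhs => rw [hex]
        simp [hc, hv]
      · right
        rw [← x.mk_rep, Projectivization.mk_eq_mk_iff']
        refine ⟨h x.rep v, ?_⟩
        conv_rhs => rw [hex]
        simp [hc, hw]
    · have aux : ∀ {y : V} (hy : y ≠ 0) {k : ℂ}, h y y = 0 → R y = k • y →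
          h (Projectivization.mk ℂ y hy).rep (Projectivization.mk ℂ y hy).rep = 0 ∧
            IsFixedPoint R (Projectivization.mk ℂ y hy) := by
        intro y hy k hyy hRy
        obtain ⟨a, ha, hrep⟩ := exists_rep_mk_eq_smul y hy
        refine ⟨by rw [hrep]; simp [hyy], k, ?_⟩
        rw [End.hasEigenvector_iff, End.mem_eigenspace_iff]
        exact ⟨by rw [hrep, map_smul, hRy, smul_comm], Projectivization.rep_nonzero _⟩
      rintro (rfl | rfl)
      · exact aux hv0 F.vv F.eig_v
      · exact aux hw0 F.ww F.eig_w
  rw [IsLoxodromic, key, Set.encard_pair]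
  rw [Ne, Projectivization.mk_eq_mk_iff']
  rintro ⟨a, rfl⟩
  simpa [F.ww] using F.vw

theorem IsHermitianSig21.exists_loxFrame_of_isLoxodromic (hh : IsHermitianSig21 h)
    (hR : ∀ x y, h (R x) (R y) = h x y) (hlox : IsLoxodromic h R) {c : V} {n : ℂ}
    (hRc : R c = n • c) (hn : ‖n‖ = 1) (hc : c ≠ 0) :
    ∃ (v w : V) (r l m : ℂ), r ≠ 0 ∧ IsLoxFrame h R (r • c) v w n l m := by
  obtain ⟨X, Y, hXY, hset⟩ := Set.encard_eq_two.1 hlox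
  have hX : X ∈ {x : ℙ ℂ V | signature h x = 0 ∧ IsFixedPoint R x} := by rw [hset]; simp
  have hY : Y ∈ {x : ℙ ℂ V | signature h x = 0 ∧ IsFixedPoint R x} := by rw [hset]; simp
  obtain ⟨hX0, l, hl⟩ := hX
  obtain ⟨hY0, m, hm⟩ := hY
  rw [signature_eq_zero_iff hh] at hX0 hY0
  have hli := linearIndependent_rep hXY
  have hab := hh.apply_ne_zero_of_isotropic hX0 hY0 hli
  have hRa := hl.apply_eq_smul
  have hRb := hm.apply_eq_smul
  suffices hl1 : ‖l‖ ≠ 1 by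
    obtain ⟨r, t, hr, -, F⟩ :=
      hh.exists_loxFrame_of_eigenvectors hR hRa hRb hRc hn hl1 hX0 hY0 hab hc
    exact ⟨_, _, r, l, m, hr, F⟩
  -- If `|l| = 1`, then `m = l` and `R` is a scalar on the whole line through `X` and `Y`, which
  -- contains further isotropic points.
  intro hl1
  have hlm : l * conj m = 1 := mul_conj_eq_one_of_eigenvectors hR hRa hRb hab
  have hml : m = l := by
    have hl0 : l ≠ 0 := by rintro rfl; simp at hl1
    have : conj m = conj l := mul_left_cancel₀ hl0 (hlm.trans (mul_conj_eq_one hl1).symm)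
    exact (starRingEnd ℂ).injective this
  subst hml
  -- The factor `i` makes the two cross terms of `⟨X + tY, X + tY⟩` purely imaginary and conjugate,
  -- so they cancel.
  obtain ⟨t, ht⟩ : ∃ t : ℂ, t = Complex.I * h X.rep Y.rep := ⟨_, rfl⟩
  have ht0 : t ≠ 0 := by rw [ht]; exact mul_ne_zero Complex.I_ne_zero hab
  have hz0 : X.rep + t • Y.rep ≠ 0 := fun h0 => by
    have := (LinearIndependent.pair_iff.1 hli 1 t (by simpa using h0)).1
    exact one_ne_zero this
  have hmem : Projectivization.mk ℂ _ hz0 ∈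
      {x : ℙ ℂ V | signature h x = 0 ∧ IsFixedPoint R x} := by
    obtain ⟨a, ha, hrep⟩ := exists_rep_mk_eq_smul _ hz0
    refine ⟨?_, m, ?_⟩
    · rw [signature_eq_zero_iff hh, hrep]
      have : h (X.rep + t • Y.rep) (X.rep + t • Y.rep) = 0 := by
        simp only [map_add, map_smul, map_smulₛₗ, LinearMap.add_apply, LinearMap.smul_apply,
          smul_eq_mul, hX0, hY0, ht, map_mul, Complex.conj_I, hh.conj_apply]
        ring
      simp only [map_smul, map_smulₛₗ, LinearMap.smul_apply, this, smul_zero]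
    · rw [End.hasEigenvector_iff, End.mem_eigenspace_iff]
      refine ⟨?_, Projectivization.rep_nonzero _⟩
      rw [hrep, map_smul, map_add, map_smul, hRa, hRb, smul_comm t m, ← smul_add, smul_comm]
  rw [hset] at hmem
  rcases hmem with hmem | hmem
  · obtain ⟨a, ha⟩ := exists_smul_rep_of_mk_eq hmem
    have := (LinearIndependent.pair_iff.1 hli (1 - a) t (by rw [sub_smul, ← ha]; module)).2
    exact ht0 this
  · obtain ⟨a, ha⟩ := exists_smul_rep_of_mk_eq (Set.mem_singleton_iff.1 hmem)
    have := (LinearIndependent.pair_iff.1 hli 1 (t - a) (by rw [sub_smul, ← ha]; module)).1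
    exact one_ne_zero this

end Lox

/-- The tance `|⟨p, q⟩|² / (⟨p, p⟩ ⟨q, q⟩)` of two points. -/
noncomputable def tance (h : SesqForm V) (p q : ℙ ℂ V) : ℝ :=
  ‖h p.rep q.rep‖ ^ 2 / ((h p.rep p.rep).re * (h q.rep q.rep).re)

/-! ### Products of two special elliptic isometries and the tance. -/

section Pair

variable {h : SesqForm V}

theorem tance_comm (hh : IsHermitianSig21 h) (p q : ℙ ℂ V) : tance h p q = tance h q p := by
  rw [tance, tance, ← hh.conj_apply, Complex.norm_conj, mul_comm (h p.rep p.rep).re]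

theorem ofReal_tance (hh : IsHermitianSig21 h) (p q : ℙ ℂ V) :
    ((tance h p q : ℝ) : ℂ)
      = h p.rep q.rep * h q.rep p.rep / (h p.rep p.rep * h q.rep q.rep) := by
  rw [tance]
  push_cast
  rw [hh.ofReal_re, hh.ofReal_re, ← Complex.mul_conj', hh.conj_apply]

theorem norm_parameter_inv_sq {α : ℂ} (hα : ‖α‖ = 1) : ‖(α ^ 2)⁻¹‖ = 1 := by
  rw [norm_inv, norm_pow, hα]; norm_num

/-- The product of two special elliptic isometries acts on the orthogonal complement of the line
of their centres by a scalar. -/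
theorem mul_specialElliptic_of_orthogonal {α β : ℂ} {p q : ℙ ℂ V} {c : V}
    (hp : h c p.rep = 0) (hq : h c q.rep = 0) :
    (specialElliptic h β q * specialElliptic h α p) c = (β * α) • c := by
  rw [Module.End.mul_apply, specialElliptic_of_orthogonal hp, map_smul,
    specialElliptic_of_orthogonal hq, smul_smul, mul_comm]

theorem mul_specialElliptic_isometry (hh : IsHermitianSig21 h) {α β : ℂ} (hα : ‖α‖ = 1)
    (hβ : ‖β‖ = 1) {p q : ℙ ℂ V} (hp : h p.rep p.rep ≠ 0) (hq : h q.rep q.rep ≠ 0) (x y : V) :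
    h ((specialElliptic h β q * specialElliptic h α p) x)
      ((specialElliptic h β q * specialElliptic h α p) y) = h x y := by
  rw [Module.End.mul_apply, Module.End.mul_apply, specialElliptic_isometry hh hβ hq,
    specialElliptic_isometry hh hα hp]

/-- A loxodromic frame for the product of the special elliptic isometries centred at `p`, `q`, with
`c` orthogonal to both centres. -/
structure IsPairFrame (h : SesqForm V) (α β : ℂ) (p q : ℙ ℂ V) (c v w : V) (l m : ℂ) : Prop
    extends IsLoxFrame h (specialElliptic h β q * specialElliptic h α p) c v w (β * α) l m where
  left_orthogonal : h p.rep c = 0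
  right_orthogonal : h q.rep c = 0

theorem exists_pairFrame_of_isLoxodromic (hh : IsHermitianSig21 h) {α β : ℂ} (hα : ‖α‖ = 1)
    (hβ : ‖β‖ = 1) {p q : ℙ ℂ V} (hp : h p.rep p.rep ≠ 0) (hq : h q.rep q.rep ≠ 0)
    (hlox : IsLoxodromic h (specialElliptic h β q * specialElliptic h α p)) :
    ∃ c v w l m, IsPairFrame h α β p q c v w l m := by
  obtain ⟨c, hc, hcp, hcq⟩ := hh.exists_orthogonal p.rep q.rep
  obtain ⟨v, w, r, l, m, -, F⟩ := hh.exists_loxFrame_of_isLoxodromic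
    (mul_specialElliptic_isometry hh hα hβ hp hq) hlox
    (mul_specialElliptic_of_orthogonal hcp hcq) (by rw [norm_mul, hα, hβ, one_mul]) hc
  exact ⟨r • c, v, w, l, m, F, by rw [apply_smul_right, hh.apply_eq_zero_symm hcp, mul_zero],
    by rw [apply_smul_right, hh.apply_eq_zero_symm hcq, mul_zero]⟩

theorem exists_roots_of_norm {T δ : ℂ} (hδ : ‖δ‖ = 1) (hT : 2 < ‖T‖) :
    ∃ l m : ℂ, l + m = T ∧ l * m = δ ∧ ‖l‖ ≠ 1 ∧ ‖m‖ ≠ 1 ∧ l ≠ m := by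
  obtain ⟨s, hs⟩ := IsAlgClosed.exists_pow_nat_eq (T ^ 2 - 4 * δ) (n := 2) two_pos
  obtain ⟨l, hl⟩ : ∃ l, l = (T + s) / 2 := ⟨_, rfl⟩
  obtain ⟨m, hm⟩ : ∃ m, m = (T - s) / 2 := ⟨_, rfl⟩
  have hadd : l + m = T := by rw [hl, hm]; ring
  have hmul : l * m = δ := by rw [hl, hm]; linear_combination (-1 / 4) * hs
  have hn : ‖l‖ * ‖m‖ = 1 := by rw [← norm_mul, hmul, hδ]
  have hle : ‖T‖ ≤ ‖l‖ + ‖m‖ := hadd ▸ norm_add_le l m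
  refine ⟨l, m, hadd, hmul, fun h1 => ?_, fun h1 => ?_, ?_⟩
  · rw [h1, one_mul] at hn; linarith
  · rw [h1, mul_one] at hn; linarith
  · intro h1
    rw [← h1] at hn hle
    nlinarith [norm_nonneg l]

/-- On the line of the centres the product has a unit determinant, and its trace is the tance times
`(α⁻² - α)(β⁻² - β)` plus two unit numbers. The constant `4` thus forces a trace of modulus above
`2`, hence eigenvalues off the unit circle, and eigenvectors for these are isotropic. -/
theorem exists_pairFrame_of_tance (hh : IsHermitianSig21 h) {α β : ℂ} (hα : ‖α‖ = 1)
    (hβ : ‖β‖ = 1) {p q : ℙ ℂ V} (hp : h p.rep p.rep ≠ 0) (hq : h q.rep q.rep ≠ 0) (hpq : p ≠ q)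
    (hbig : 4 < ‖(α ^ 2)⁻¹ - α‖ * ‖(β ^ 2)⁻¹ - β‖ * |tance h p q|) :
    ∃ c v w l m, IsPairFrame h α β p q c v w l m := by
  obtain ⟨c, hc, hcp, hcq⟩ := hh.exists_orthogonal p.rep q.rep
  have hR := mul_specialElliptic_isometry hh hα hβ hp hq
  have hα0 : α ≠ 0 := by rintro rfl; simp at hα
  have hβ0 : β ≠ 0 := by rintro rfl; simp at hβ
  have ht0 : tance h p q ≠ 0 := by
    intro h0; rw [h0, abs_zero, mul_zero] at hbig; linarith
  have hqp0 : h q.rep p.rep ≠ 0 := by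
    intro h0
    rw [tance, hh.apply_eq_zero_symm h0] at ht0
    simp at ht0
  have hu := ofReal_tance hh p q
  have hli := linearIndependent_rep hpq
  obtain ⟨a, ha⟩ : ∃ a, a = (α ^ 2)⁻¹ - α := ⟨_, rfl⟩
  obtain ⟨b, hb⟩ : ∃ b, b = (β ^ 2)⁻¹ - β := ⟨_, rfl⟩
  rw [← ha, ← hb] at hbig
  have ha0 : a ≠ 0 := by
    rintro rfl; rw [norm_zero, zero_mul, zero_mul] at hbig; linarith
  -- `A`, `C` and `B`, `D` are the columns of the matrix of the product in the basis `p.rep`,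
  -- `q.rep`.
  obtain ⟨A, hA⟩ : ∃ A, A = (α ^ 2)⁻¹ * β := ⟨_, rfl⟩
  obtain ⟨C, hC⟩ : ∃ C, C = (α ^ 2)⁻¹ * (b * (h p.rep q.rep / h q.rep q.rep)) := ⟨_, rfl⟩
  obtain ⟨B, hB⟩ : ∃ B, B = a * (h q.rep p.rep / h p.rep p.rep) * β := ⟨_, rfl⟩
  obtain ⟨D, hD⟩ : ∃ D, D = α * (β ^ 2)⁻¹ + a * b * tance h p q := ⟨_, rfl⟩
  have hB0 : B ≠ 0 := by
    rw [hB]; exact mul_ne_zero (mul_ne_zero ha0 (div_ne_zero hqp0 hp)) hβ0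
  have hRp : (specialElliptic h β q * specialElliptic h α p) p.rep = A • p.rep + C • q.rep := by
    rw [Module.End.mul_apply, specialElliptic_rep hp, map_smul, specialElliptic_apply, ← hb, hA,
      hC]
    module
  have hRq : (specialElliptic h β q * specialElliptic h α p) q.rep = B • p.rep + D • q.rep := by
    rw [Module.End.mul_apply, specialElliptic_apply h α, ← ha, map_add, map_smul, map_smul,
      specialElliptic_rep hq, specialElliptic_apply, ← hb, hB, hD, hu, mul_div_mul_comm]
    module
  have hdet : A * D - B * C = (α * β)⁻¹ := by
    rw [hA, hD, hB, hC, hu]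
    field_simp
    ring
  have hT : 2 < ‖A + D‖ := by
    have h1 : ‖a * b * tance h p q‖ ≤ ‖A + D‖ + 2 := by
      have : a * b * tance h p q = (A + D) - (α ^ 2)⁻¹ * β - α * (β ^ 2)⁻¹ := by
        rw [hA, hD]; ring
      rw [this]
      refine (norm_sub_le _ _).trans ?_
      have h2 := norm_sub_le (A + D) ((α ^ 2)⁻¹ * β)
      rw [norm_mul, norm_parameter_inv_sq hα, hβ] at h2
      rw [norm_mul α, norm_parameter_inv_sq hβ, hα]
      linarith
    rw [norm_mul, norm_mul, Complex.norm_real, Real.norm_eq_abs] at h1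
    linarith
  obtain ⟨l, m, hadd, hmul, hl, hm, hlm⟩ := exists_roots_of_norm
    (by rw [norm_inv, norm_mul, hα, hβ]; norm_num : ‖(α * β)⁻¹‖ = 1) hT
  -- The hypothesis on `k` is the characteristic equation; the vector is the usual eigenvector of a
  -- two-by-two matrix, nonzero because `B ≠ 0`.
  have heig : ∀ {k : ℂ}, B * C + (k - A) * D = k * (k - A) →
      (specialElliptic h β q * specialElliptic h α p) (B • p.rep + (k - A) • q.rep)
        = k • (B • p.rep + (k - A) • q.rep) := by
    intro k hk
    rw [map_add, map_smul, map_smul, hRp, hRq]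
    rw [show B • (A • p.rep + C • q.rep) + (k - A) • (B • p.rep + D • q.rep)
      = (k * B) • p.rep + (B * C + (k - A) * D) • q.rep by module, hk]
    module
  have hRl := heig (k := l) (by linear_combination -hdet - l * hadd + hmul)
  have hRm := heig (k := m) (by linear_combination -hdet - m * hadd + hmul)
  have hiso : ∀ {x : V} {k : ℂ},
      (specialElliptic h β q * specialElliptic h α p) x = k • x → ‖k‖ ≠ 1 → h x x = 0 := by
    intro x k hx hk
    by_contra h0
    exact hk (norm_eq_one_of_mul_conj (mul_conj_eq_one_of_eigenvectors hR hx hx h0))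
  have hind : LinearIndependent ℂ
      ![B • p.rep + (l - A) • q.rep, B • p.rep + (m - A) • q.rep] := by
    rw [LinearIndependent.pair_iff]
    intro s t hst
    obtain ⟨h1, h2⟩ := LinearIndependent.pair_iff.1 hli (s * B + t * B)
      (s * (l - A) + t * (m - A)) (by rw [← hst]; module)
    have h3 : s + t = 0 := mul_right_cancel₀ hB0 (by rw [zero_mul, add_mul, h1])
    have h4 : s = 0 := mul_right_cancel₀ (sub_ne_zero.2 hlm)
      (by linear_combination h2 - (m - A) * h3)
    exact ⟨h4, by simpa [h4] using h3⟩
  obtain ⟨r, t, -, -, F⟩ := hh.exists_loxFrame_of_eigenvectors hR hRl hRm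
    (mul_specialElliptic_of_orthogonal hcp hcq) (by rw [norm_mul, hα, hβ, one_mul]) hl
    (hiso hRl hl) (hiso hRm hm)
    (hh.apply_ne_zero_of_isotropic (hiso hRl hl) (hiso hRm hm) hind) hc
  exact ⟨r • c, _, _, l, m, F, by rw [apply_smul_right, hh.apply_eq_zero_symm hcp, mul_zero],
    by rw [apply_smul_right, hh.apply_eq_zero_symm hcq, mul_zero]⟩

end Pair

/-! ### The action of `SU(2,1)` on points and Gram matrices. -/

section Action

variable {h : SesqForm V}

theorem SU_apply (g : SU h) (x y : V) : h (g • x) (g • y) = h x y := g.2.1 x y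

theorem exists_rep_smul (g : SU h) (p : ℙ ℂ V) :
    ∃ a : ℂ, a ≠ 0 ∧ (g • p).rep = a • (g • p.rep) := by
  have : g • p = Projectivization.mk ℂ (g • p.rep)
      ((smul_ne_zero_iff_ne g).mpr p.rep_nonzero) := by
    conv_lhs => rw [← p.mk_rep]
    exact Projectivization.smul_mk g p.rep_nonzero
  rw [this]
  exact exists_rep_mk_eq_smul _ _

theorem smul_eq_of_rep {g : SU h} {p q : ℙ ℂ V} {a : ℂ} (hpq : g • p.rep = a • q.rep) :
    g • p = q := by
  obtain ⟨b, -, hb⟩ := exists_rep_smul g p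
  refine eq_of_rep_eq_smul (a := b * a) ?_
  rw [hb, hpq, smul_smul]

theorem SU_smul_smul (g : SU h) (a : ℂ) (x : V) : g • (a • x) = a • g • x :=
  map_smul (g : V ≃ₗ[ℂ] V) a x

theorem SU_smul_add (g : SU h) (x y : V) : g • (x + y) = g • x + g • y :=
  map_add (g : V ≃ₗ[ℂ] V) x y

theorem specialElliptic_smul (g : SU h) (α : ℂ) (p : ℙ ℂ V) (x : V) :
    specialElliptic h α (g • p) (g • x) = g • specialElliptic h α p x := by
  have : g • p = Projectivization.mk ℂ (g • p.rep)
      ((smul_ne_zero_iff_ne g).mpr p.rep_nonzero) := by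
    conv_lhs => rw [← p.mk_rep]
    exact Projectivization.smul_mk g p.rep_nonzero
  rw [this, specialElliptic_mk_apply, specialElliptic_apply, SU_apply, SU_apply, SU_smul_add,
    SU_smul_smul, SU_smul_smul]

theorem signature_smul (g : SU h) (p : ℙ ℂ V) : signature h (g • p) = signature h p := by
  obtain ⟨a, ha, hrep⟩ := exists_rep_smul g p
  have : h (a • g • p.rep) (a • g • p.rep) = ((‖a‖ ^ 2 : ℝ) : ℂ) * h p.rep p.rep := by
    rw [apply_smul_left, apply_smul_right, SU_apply, ← mul_assoc, Complex.mul_conj']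
    push_cast; rfl
  rw [signature, signature, hrep, this, Complex.re_ofReal_mul, sign_mul,
    sign_pos (by positivity), one_mul]

theorem orthogonal_smul_iff (g : SU h) (p q : ℙ ℂ V) :
    Orthogonal h (g • p) (g • q) ↔ Orthogonal h p q := by
  obtain ⟨a, ha, hp⟩ := exists_rep_smul g p
  obtain ⟨b, hb, hq⟩ := exists_rep_smul g q
  rw [Orthogonal, Orthogonal, hp, hq, apply_smul_left, apply_smul_right, SU_apply]
  simp [ha, hb]

/-- Take determinants in `Mᵀ G M̄ = G`, where `G` is the invertible Gram matrix of an orthogonal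
basis. -/
theorem IsHermitianSig21.norm_det_of_isometry (hh : IsHermitianSig21 h) (f : End ℂ V)
    (hf : ∀ x y, h (f x) (f y) = h x y) : ‖LinearMap.det f‖ = 1 := by
  obtain ⟨-, b, horth, h0, h1, h2⟩ := hh
  set M := LinearMap.toMatrix b b f with hM
  set G : Matrix (Fin 3) (Fin 3) ℂ := Matrix.diagonal ![1, 1, -1] with hG
  have hGb : ∀ i j, h (b i) (b j) = G i j := by
    intro i j
    fin_cases i <;> fin_cases j <;> simp [hG, h0, h1, h2, horth]
  have hfb : ∀ i, f (b i) = ∑ k, M k i • b k := by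
    intro i
    conv_lhs => rw [← b.sum_repr (f (b i))]
    simp [hM, LinearMap.toMatrix_apply]
  have key : M.transpose * G * M.map conj = G := by
    ext i j
    rw [← hGb i j, ← hf, hfb, hfb]
    simp only [Matrix.mul_apply, Matrix.transpose_apply, Matrix.map_apply, map_sum,
      LinearMap.sum_apply, apply_smul_left, apply_smul_right, hGb, Finset.sum_mul]
    exact Finset.sum_congr rfl fun k _ => Finset.sum_congr rfl fun l _ => by ring
  have hdet := congrArg Matrix.det key
  have hGd : G.det ≠ 0 := by simp [hG, Fin.prod_univ_three]
  have hMd : (M.map conj).det = conj M.det := ((starRingEnd ℂ).map_det M).symm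
  rw [Matrix.det_mul, Matrix.det_mul, Matrix.det_transpose, hMd] at hdet
  rw [← LinearMap.det_toMatrix b f]
  exact norm_eq_one_of_mul_conj (mul_right_cancel₀ hGd (by linear_combination hdet))

/-- Up to a scalar, every isometry lies in `SU(2,1)`. -/
theorem IsHermitianSig21.exists_SU_of_isometry (hh : IsHermitianSig21 h) (f : V ≃ₗ[ℂ] V)
    (hf : ∀ x y, h (f x) (f y) = h x y) :
    ∃ (g : SU h) (z : ℂ), z ≠ 0 ∧ ∀ x : V, g • x = z • f x := by
  have hd := hh.norm_det_of_isometry (f : End ℂ V) hf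
  -- In dimension three the scalar `z` multiplies the determinant by `z ^ 3`, so a cube root of the
  -- inverse determinant is needed. It has modulus one, which keeps the form invariant.
  obtain ⟨z, hz⟩ := IsAlgClosed.exists_pow_nat_eq (LinearMap.det (f : End ℂ V))⁻¹ (n := 3)
    (by norm_num)
  have hzn : ‖z‖ = 1 := by
    have : ‖z‖ ^ 3 = 1 := by rw [← norm_pow, hz, norm_inv, hd, inv_one]
    exact (pow_eq_one_iff_of_nonneg (norm_nonneg z) (by norm_num)).1 this
  have hz0 : z ≠ 0 := by rintro rfl; simp at hzn
  refine ⟨⟨f.trans (LinearEquiv.smulOfNeZero ℂ V z hz0), fun x y => ?_, ?_⟩, z, hz0,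
    fun x => rfl⟩
  · change h (z • f x) (z • f y) = h x y
    rw [apply_smul_left, apply_smul_right, hf, ← mul_assoc, mul_conj_eq_one hzn, one_mul]
  · refine Units.ext ?_
    rw [LinearEquiv.coe_det]
    have : ((f.trans (LinearEquiv.smulOfNeZero ℂ V z hz0) : V ≃ₗ[ℂ] V) : End ℂ V)
        = z • (f : End ℂ V) := rfl
    rw [this, LinearMap.det_smul, hh.finrank_eq, hz, inv_mul_cancel₀]
    · rfl
    · intro h0; rw [h0] at hd; simp at hd

/-- Linearly independent triples with the same Gram matrix are congruent. -/
theorem IsHermitianSig21.exists_SU_of_gram (hh : IsHermitianSig21 h) {P Q : Fin 3 → V}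
    (hP : LinearIndependent ℂ P) (hQ : LinearIndependent ℂ Q)
    (hPQ : ∀ i j, h (P i) (P j) = h (Q i) (Q j)) :
    ∃ (g : SU h) (z : ℂ), z ≠ 0 ∧ ∀ i, g • P i = z • Q i := by
  let bP := basisOfLinearIndependentOfCardEqFinrank hP (by simp [hh.finrank_eq])
  let bQ := basisOfLinearIndependentOfCardEqFinrank hQ (by simp [hh.finrank_eq])
  have ebP : ∀ i, bP i = P i := fun i => by simp [bP]
  have ebQ : ∀ i, bQ i = Q i := fun i => by simp [bQ]
  let f := bP.equiv bQ (Equiv.refl _)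
  have hfP : ∀ i, f (P i) = Q i := fun i => by
    rw [← ebP, ← ebQ]; simp [f]
  obtain ⟨g, z, hz, hg⟩ := hh.exists_SU_of_isometry f fun x y => by
    rw [← bP.sum_repr x, ← bP.sum_repr y]
    simp only [map_sum, LinearMap.sum_apply, map_smul f, apply_smul_left, apply_smul_right, ebP,
      hfP, hPQ]
  exact ⟨g, z, hz, fun i => by rw [hg, hfP]⟩

end Action

/-- `i`, `j` are the first two or the last two indices, and `k` is the remaining one. -/
def IsConsecutive (i j k : Fin 3) : Prop :=
  (i = 0 ∧ j = 1 ∧ k = 2) ∨ (i = 1 ∧ j = 2 ∧ k = 0)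

theorem IsConsecutive.ne {i j k : Fin 3} (hc : IsConsecutive i j k) : i ≠ j ∧ i ≠ k ∧ j ≠ k := by
  rcases hc with ⟨rfl, rfl, rfl⟩ | ⟨rfl, rfl, rfl⟩ <;> decide

theorem IsConsecutive.eq_or {i j k : Fin 3} (hc : IsConsecutive i j k) (x : Fin 3) :
    x = i ∨ x = j ∨ x = k := by
  rcases hc with ⟨rfl, rfl, rfl⟩ | ⟨rfl, rfl, rfl⟩ <;> revert x <;> decide

theorem IsConsecutive.sum_eq {M : Type*} [AddCommMonoid M] {i j k : Fin 3}
    (hc : IsConsecutive i j k) (f : Fin 3 → M) :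
    ∑ x, f x = f i + f j + f k := by
  rw [Fin.sum_univ_three]
  rcases hc with ⟨rfl, rfl, rfl⟩ | ⟨rfl, rfl, rfl⟩
  · rfl
  · rw [add_rotate]

/-! ### Strongly regular triples. -/

section Triple

variable {h : SesqForm V} {α : Fin 3 → ℂ} {σ : Fin 3 → SignType} {τ : ℂ} {p q : Fin 3 → ℙ ℂ V}

theorem IsConsecutive.trace_eq {i j k : Fin 3} (hc : IsConsecutive i j k) :
    LinearMap.trace ℂ V (tripleProduct h α p)
      = LinearMap.trace ℂ V (specialElliptic h (α k) (p k) * pairProduct h α p i j) := by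
  rcases hc with ⟨rfl, rfl, rfl⟩ | ⟨rfl, rfl, rfl⟩
  · rw [tripleProduct, pairProduct, mul_assoc]
  · rw [tripleProduct, pairProduct, LinearMap.trace_mul_comm]

theorem trace_eq_of_smul (g : SU h) {S T : End ℂ V} (hST : ∀ x, T (g • x) = g • S x) :
    LinearMap.trace ℂ V T = LinearMap.trace ℂ V S := by
  rw [← LinearMap.trace_conj' S (g : V ≃ₗ[ℂ] V)]
  congr 1
  ext x
  rw [LinearEquiv.conj_apply_apply]
  refine Eq.trans ?_ (hST _)
  congr 1
  exact ((g : V ≃ₗ[ℂ] V).apply_symm_apply x).symm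

theorem StronglyRegular.self_ne_zero (hh : IsHermitianSig21 h)
    (hp : StronglyRegular h α σ τ p) (i : Fin 3) : h (p i).rep (p i).rep ≠ 0 := by
  rw [Ne, ← signature_eq_zero_iff hh, hp.signature_eq]
  exact hp.sign_ne_zero i

theorem StronglyRegular.linearIndependent (hh : IsHermitianSig21 h)
    (hp : StronglyRegular h α σ τ p) : LinearIndependent ℂ fun i => (p i).rep := by
  have := hh.finiteDimensional
  by_contra hli
  refine hp.not_collinear ⟨Submodule.span ℂ (Set.range fun i => (p i).rep), ?_, fun i => ?_⟩
  · refine le_antisymm ?_ ?_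
    · rw [linearIndependent_iff_card_le_finrank_span] at hli
      simp only [Fintype.card_fin, Set.finrank] at hli
      omega
    · have h01 := linearIndependent_rep (hp.distinct.ne (show (0 : Fin 3) ≠ 1 by decide))
      have := finrank_span_eq_card h01
      rw [Fintype.card_fin] at this
      refine this.ge.trans ?_
      refine Submodule.finrank_mono (Submodule.span_mono ?_)
      rintro _ ⟨i, rfl⟩
      fin_cases i
      · exact ⟨0, rfl⟩
      · exact ⟨1, rfl⟩
  · rw [Projectivization.submodule_eq, Submodule.span_singleton_le_iff_mem]
    exact Submodule.subset_span ⟨i, rfl⟩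

theorem StronglyRegular.of_linearIndependent (hp : StronglyRegular h α σ τ p)
    [FiniteDimensional ℂ V]
    (hsig : ∀ i, signature h (q i) = signature h (p i))
    (hli : LinearIndependent ℂ fun i => (q i).rep)
    (hl : ¬ Orthogonal h (q 1) (q 0)) (hr : ¬ Orthogonal h (q 1) (q 2))
    (htr : LinearMap.trace ℂ V (tripleProduct h α q) = LinearMap.trace ℂ V (tripleProduct h α p)) :
    StronglyRegular h α σ τ q where
  norm_param := hp.norm_param
  param_cube := hp.param_cube
  sign_ne_zero := hp.sign_ne_zero
  at_most_one_positive := hp.at_most_one_positive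
  signature_eq i := (hsig i).trans (hp.signature_eq i)
  distinct i j hij := hli.injective (congrArg Projectivization.rep hij)
  not_orthogonal_left := hl
  not_orthogonal_right := hr
  not_collinear := by
    rintro ⟨W, hW, hqW⟩
    have hle : Submodule.span ℂ (Set.range fun i => (q i).rep) ≤ W := by
      rw [Submodule.span_le]
      rintro _ ⟨i, rfl⟩
      refine hqW i ?_
      rw [Projectivization.submodule_eq]
      exact Submodule.mem_span_singleton_self _
    have := Submodule.finrank_mono hle
    rw [finrank_span_eq_card hli, hW, Fintype.card_fin] at this
    omega
  trace_eq := htr.trans hp.trace_eq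

theorem StronglyRegular.smul (hh : IsHermitianSig21 h) (hp : StronglyRegular h α σ τ p)
    (g : SU h) : StronglyRegular h α σ τ fun i => g • p i := by
  have := hh.finiteDimensional
  refine hp.of_linearIndependent (fun i => signature_smul g _) ?_ ?_ ?_ ?_
  · choose a ha hrep using fun i => exists_rep_smul g (p i)
    simp only [hrep]
    have hg : LinearIndependent ℂ fun i => g • (p i).rep :=
      (hp.linearIndependent hh).map' ((g : V ≃ₗ[ℂ] V) : V →ₗ[ℂ] V) (LinearEquiv.ker _)
    exact hg.units_smul fun i => Units.mk0 (a i) (ha i)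
  · rw [orthogonal_smul_iff]; exact hp.not_orthogonal_left
  · rw [orthogonal_smul_iff]; exact hp.not_orthogonal_right
  · refine trace_eq_of_smul g fun x => ?_
    simp only [tripleProduct, Module.End.mul_apply, specialElliptic_smul]

end Triple

/-! ### Bendings in the frame of a loxodromic pair. -/

section PairFrame

variable {h : SesqForm V} {α β : ℂ} {x y : ℙ ℂ V} {c v w : V} {l m : ℂ}

theorem IsLoxFrame.apply_eq_diagMap {R : End ℂ V} {n : ℂ} (F : IsLoxFrame h R c v w n l m)
    (hV : finrank ℂ V = 3) (z : V) : R z = diagMap h c v w n l m z := by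
  conv_lhs => rw [F.expand hV z]
  simp only [map_add, map_smul, F.eig_c, F.eig_v, F.eig_w, smul_smul, diagMap_apply, mul_comm]

theorem IsLoxFrame.commute_bend {R : End ℂ V} {n : ℂ} (F : IsLoxFrame h R c v w n l m)
    (hV : finrank ℂ V = 3) (s : ℝ) (z : V) : R (F.bend hV s • z) = F.bend hV s • R z := by
  rw [F.apply_eq_diagMap hV, F.apply_eq_diagMap hV, F.bend_smul, F.bend_smul,
    F.diagMap_diagMap, F.diagMap_diagMap, mul_comm n, mul_comm l, mul_comm m]

theorem IsWittFrame.bend_smul_eq_self {F : IsWittFrame h c v w} (hV : finrank ℂ V = 3) {s : ℝ}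
    {z : V} (hv : h z v = 0) (hw : h z w = 0) : F.bend hV s • z = z := by
  conv_rhs => rw [F.expand hV z]
  rw [F.bend_smul, diagMap_apply, hv, hw]
  simp

theorem IsWittFrame.exists_combination (F : IsWittFrame h c v w) (hV : finrank ℂ V = 3)
    {a b z : V} (hab : LinearIndependent ℂ ![a, b]) (ha : h a c = 0) (hb : h b c = 0)
    (hz : h z c = 0) : ∃ s t : ℂ, s • a + t • b = z := by
  have ea := F.expand hV a
  have eb := F.expand hV b
  have ez := F.expand hV z
  rw [ha, zero_smul, zero_add] at ea
  rw [hb, zero_smul, zero_add] at eb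
  rw [hz, zero_smul, zero_add] at ez
  generalize h a w = a₁ at *
  generalize h a v = a₂ at *
  generalize h b w = b₁ at *
  generalize h b v = b₂ at *
  generalize h z w = z₁ at *
  generalize h z v = z₂ at *
  have hd : a₁ * b₂ - a₂ * b₁ ≠ 0 := by
    intro hd
    have h1 : b₂ • a + (-a₂) • b = 0 := by
      rw [ea, eb, show b₂ • (a₁ • v + a₂ • w) + (-a₂) • (b₁ • v + b₂ • w)
        = (a₁ * b₂ - a₂ * b₁) • v by module, hd, zero_smul]
    have h2 : (-b₁) • a + a₁ • b = 0 := by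
      rw [ea, eb, show (-b₁) • (a₁ • v + a₂ • w) + a₁ • (b₁ • v + b₂ • w)
        = (a₁ * b₂ - a₂ * b₁) • w by module, hd, zero_smul]
    have h3 := (LinearIndependent.pair_iff.1 hab _ _ h1).2
    have h4 := (LinearIndependent.pair_iff.1 hab _ _ h2).2
    have : a = 0 := by rw [ea, h4, neg_eq_zero.1 h3, zero_smul, zero_smul, add_zero]
    exact hab.ne_zero 0 this
  obtain ⟨d, hd⟩ : ∃ d, d * (a₁ * b₂ - a₂ * b₁) = 1 := ⟨_, inv_mul_cancel₀ hd⟩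
  refine ⟨d * (z₁ * b₂ - z₂ * b₁), d * (a₁ * z₂ - a₂ * z₁), ?_⟩
  rw [ea, eb, ez, show (d * (z₁ * b₂ - z₂ * b₁)) • (a₁ • v + a₂ • w)
    + (d * (a₁ * z₂ - a₂ * z₁)) • (b₁ • v + b₂ • w)
    = (d * (a₁ * b₂ - a₂ * b₁)) • (z₁ • v + z₂ • w) by module, hd, one_smul]

theorem IsPairFrame.isBendingGroup (hh : IsHermitianSig21 h)
    (F : IsPairFrame h α β x y c v w l m) (hxy : x ≠ y) :
    IsBendingGroup h (specialElliptic h β y * specialElliptic h α x)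
      (x.submodule ⊔ y.submodule) (F.1.bend hh.finrank_eq) := by
  obtain ⟨F, hx, hy⟩ := F
  have hV := hh.finrank_eq
  have hmem : ∀ {z}, h z c = 0 → z ∈ x.submodule ⊔ y.submodule := by
    intro z hz
    obtain ⟨s, t, hst⟩ := F.exists_combination hV (linearIndependent_rep hxy) hx hy hz
    rw [Projectivization.submodule_eq, Projectivization.submodule_eq, Submodule.mem_sup]
    exact ⟨_, Submodule.smul_mem _ s (Submodule.mem_span_singleton_self _), _,
      Submodule.smul_mem _ t (Submodule.mem_span_singleton_self _), hst⟩
  refine Or.inr (Or.inl ⟨F.isLoxodromic hh, c, v, w, ?_, ?_, hmem F.vc, hmem F.wc, F.vv, F.ww, ?_,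
    ⟨l, ?_⟩, ⟨m, ?_⟩, fun s => ⟨?_, ?_, ?_⟩⟩)
  · rintro rfl; simpa using F.cc
  · intro z hz
    rw [Projectivization.submodule_eq, Projectivization.submodule_eq, Submodule.mem_sup] at hz
    obtain ⟨a, ha, b, hb, rfl⟩ := hz
    obtain ⟨s, rfl⟩ := Submodule.mem_span_singleton.1 ha
    obtain ⟨t, rfl⟩ := Submodule.mem_span_singleton.1 hb
    rw [map_add, LinearMap.add_apply, apply_smul_left, apply_smul_left, hx, hy, mul_zero,
      mul_zero, add_zero]
  · rw [LinearIndependent.pair_iff]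
    intro s t hst
    have e1 := congrArg (fun z => h z w) hst
    have e2 := congrArg (fun z => h z v) hst
    simp only [map_add, LinearMap.add_apply, apply_smul_left, F.vv, F.ww, F.vw, F.wv, map_zero,
      LinearMap.zero_apply, mul_one, mul_zero, add_zero, zero_add] at e1 e2
    exact ⟨e1, e2⟩
  · rw [End.hasEigenvector_iff, End.mem_eigenspace_iff]
    exact ⟨F.eig_v, by rintro rfl; simpa using F.vw⟩
  · rw [End.hasEigenvector_iff, End.mem_eigenspace_iff]
    exact ⟨F.eig_w, by rintro rfl; simpa using F.vw⟩
  · exact F.bend_smul_eq_self hV F.cv F.cw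
  · rw [F.bend_smul, diagMap_apply, F.vc, F.vv, F.vw]; simp
  · rw [F.bend_smul, diagMap_apply, F.wc, F.wv, F.ww]; simp

theorem IsWittFrame.smul (F : IsWittFrame h c v w) (g : SU h) :
    IsWittFrame h (g • c) (g • v) (g • w) := by
  constructor <;> simp only [SU_apply, F.cc, F.vv, F.ww, F.vw, F.wv, F.cv, F.vc, F.cw, F.wc]

theorem IsPairFrame.smul (F : IsPairFrame h α β x y c v w l m) (g : SU h) :
    IsPairFrame h α β (g • x) (g • y) (g • c) (g • v) (g • w) l m := by
  obtain ⟨F, hx, hy⟩ := F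
  obtain ⟨a, -, ha⟩ := exists_rep_smul g x
  obtain ⟨b, -, hb⟩ := exists_rep_smul g y
  refine ⟨⟨F.toIsWittFrame.smul g, ?_, ?_, ?_, F.norm_n, F.norm_l, F.mul_conj⟩, ?_, ?_⟩
  · have := F.eig_c
    rw [Module.End.mul_apply] at this ⊢
    rw [specialElliptic_smul, specialElliptic_smul, this, SU_smul_smul]
  · have := F.eig_v
    rw [Module.End.mul_apply] at this ⊢
    rw [specialElliptic_smul, specialElliptic_smul, this, SU_smul_smul]
  · have := F.eig_w
    rw [Module.End.mul_apply] at this ⊢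
    rw [specialElliptic_smul, specialElliptic_smul, this, SU_smul_smul]
  · rw [ha, apply_smul_left, SU_apply, hx, mul_zero]
  · rw [hb, apply_smul_left, SU_apply, hy, mul_zero]

theorem IsWittFrame.bend_conj (F : IsWittFrame h c v w) (hV : finrank ℂ V = 3) (g : SU h)
    (s : ℝ) : (F.smul g).bend hV s * g = g * F.bend hV s := by
  refine Subtype.ext (LinearEquiv.ext fun z => ?_)
  change (F.smul g).bend hV s • g • z = g • F.bend hV s • z
  rw [IsWittFrame.bend_smul, IsWittFrame.bend_smul, diagMap_apply, diagMap_apply]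
  simp only [SU_apply, SU_smul_add, SU_smul_smul]

end PairFrame

/-! ### Moves of the third point in place of bendings. -/

section Move

variable {h : SesqForm V} {α : Fin 3 → ℂ} {σ : Fin 3 → SignType} {τ : ℂ} {p q : Fin 3 → ℙ ℂ V}

/-- The triple `q` arises from `p` by moving one of the outer points by a loxodromic bending of the
other two. -/
def Move (h : SesqForm V) (α : Fin 3 → ℂ) (σ : Fin 3 → SignType) (τ : ℂ)
    (p q : Fin 3 → ℙ ℂ V) : Prop :=
  StronglyRegular h α σ τ p ∧ StronglyRegular h α σ τ q ∧
    ∃ i j k c v w l m, IsConsecutive i j k ∧ IsPairFrame h (α i) (α j) (p i) (p j) c v w l m ∧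
      q i = p i ∧ q j = p j ∧
        ∃ (F : IsWittFrame h c v w) (hV : finrank ℂ V = 3) (s : ℝ), q k = F.bend hV s • p k

theorem Move.symm (hpq : Move h α σ τ p q) : Move h α σ τ q p := by
  obtain ⟨hp, hq, i, j, k, c, v, w, l, m, hc, F, hi, hj, F', hV, s, hk⟩ := hpq
  refine ⟨hq, hp, i, j, k, c, v, w, l, m, hc, by rwa [hi, hj], hi.symm, hj.symm, F', hV, -s, ?_⟩
  rw [hk, F'.bend_neg, inv_smul_smul]

theorem Move.smul (hh : IsHermitianSig21 h) (hpq : Move h α σ τ p q) (g : SU h) :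
    Move h α σ τ (fun i => g • p i) (fun i => g • q i) := by
  obtain ⟨hp, hq, i, j, k, c, v, w, l, m, hc, F, hi, hj, F', hV, s, hk⟩ := hpq
  refine ⟨hp.smul hh g, hq.smul hh g, i, j, k, _, _, _, l, m, hc, F.smul g, congrArg _ hi,
    congrArg _ hj, F'.smul g, hV, s, ?_⟩
  simp only [hk]
  rw [← mul_smul, ← mul_smul, F'.bend_conj]

/-- Translate `q` by the inverse of the bending that moved `p k`: the third point returns to `p k`,
while the pair is now bent. -/
theorem Move.exists_bendingStep (hh : IsHermitianSig21 h) (hpq : Move h α σ τ p q) :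
    ∃ g : SU h, BendingStep h α σ τ p (fun i => g • q i) := by
  obtain ⟨hp, hq, i, j, k, c, v, w, l, m, hc, F, hi, hj, F', hV, s, hk⟩ := hpq
  have hB := F.isBendingGroup hh (hp.distinct.ne hc.ne.1)
  have hbend : BendsAt h α i j p (fun x => F'.bend hV (-s) • q x) := by
    refine ⟨_, -s, hB, congrArg _ hi, congrArg _ hj, fun x hxi hxj => ?_⟩
    obtain rfl : x = k := by
      rcases hc.eq_or x with h1 | h1 | h1
      · exact absurd h1 hxi
      · exact absurd h1 hxj
      · exact h1
    change F'.bend hV (-s) • q x = p x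
    rw [hk, F'.bend_neg, inv_smul_smul]
  refine ⟨F'.bend hV (-s), hp, hq.smul hh _, ?_⟩
  rcases hc with ⟨rfl, rfl, rfl⟩ | ⟨rfl, rfl, rfl⟩
  · exact Or.inl hbend
  · exact Or.inr hbend

/-- Moves and translations by `SU(2,1)`. -/
def MoveOrTranslate (h : SesqForm V) (α : Fin 3 → ℂ) (σ : Fin 3 → SignType) (τ : ℂ)
    (p q : Fin 3 → ℙ ℂ V) : Prop :=
  Move h α σ τ p q ∨ ∃ g : SU h, ∀ i, q i = g • p i

theorem Move.moveOrTranslate (hpq : Move h α σ τ p q) : MoveOrTranslate h α σ τ p q :=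
  Or.inl hpq

theorem moveOrTranslate_of_smul {g : SU h} (hg : ∀ i, q i = g • p i) :
    MoveOrTranslate h α σ τ p q :=
  Or.inr ⟨g, hg⟩

instance : Std.Symm (MoveOrTranslate h α σ τ) where
  symm p q := by
    rintro (hpq | ⟨g, hg⟩)
    · exact Or.inl hpq.symm
    · exact Or.inr ⟨g⁻¹, fun i => by rw [hg, inv_smul_smul]⟩

/-- Moves are equivariant, so all translations can be collected into one element at the end of the
sequence. -/
theorem exists_bendingSteps (hh : IsHermitianSig21 h)
    (hpq : Relation.ReflTransGen (MoveOrTranslate h α σ τ) p q) :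
    ∃ r : Fin 3 → ℙ ℂ V, Relation.ReflTransGen (BendingStep h α σ τ) p r ∧
      ∃ g : SU h, ∀ i, r i = g • q i := by
  induction hpq with
  | refl => exact ⟨p, .refl, 1, fun i => (one_smul _ _).symm⟩
  | tail _ hstep ih =>
    obtain ⟨r, hr, g, hg⟩ := ih
    rcases hstep with hm | ⟨g', hg'⟩
    · obtain ⟨g', hstep'⟩ := (hm.smul hh g).exists_bendingStep hh
      rw [← funext hg] at hstep'
      exact ⟨_, hr.tail hstep', g' * g, fun i => (mul_smul _ _ _).symm⟩
    · exact ⟨r, hr, g * g'⁻¹, fun i => by rw [hg, hg', mul_smul, inv_smul_smul]⟩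

theorem StronglyRegular.apply_ne_zero (hh : IsHermitianSig21 h) {i j k : Fin 3}
    (hc : IsConsecutive i j k) (hp : StronglyRegular h α σ τ p) {c v w : V} {l m : ℂ}
    (F : IsPairFrame h (α i) (α j) (p i) (p j) c v w l m) : h (p k).rep c ≠ 0 := by
  intro h0
  obtain ⟨F, hi, hj⟩ := F
  obtain ⟨s, t, hst⟩ := F.exists_combination hh.finrank_eq
    (linearIndependent_rep (hp.distinct.ne hc.ne.1)) hi hj h0
  have hli := Fintype.linearIndependent_iff.1 (hp.linearIndependent hh)
    (fun x => if x = i then s else if x = j then t else -1) (by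
      rw [hc.sum_eq, if_pos rfl, if_neg hc.ne.1.symm, if_pos rfl, if_neg hc.ne.2.1.symm,
        if_neg hc.ne.2.2.symm, hst]
      module) k
  simp only [if_neg hc.ne.2.1.symm, if_neg hc.ne.2.2.symm] at hli
  norm_num at hli

/-- The bending commutes with the product of the pair, so the trace is unchanged. It also preserves
the `c`-coordinate, whose nonvanishing is what keeps the third point off the line of the pair. Only
nonorthogonality to `p 1` can be lost. -/
theorem StronglyRegular.update_bend (hh : IsHermitianSig21 h) {i j k : Fin 3}
    (hc : IsConsecutive i j k) (hp : StronglyRegular h α σ τ p) {c v w : V} {l m : ℂ}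
    (F : IsPairFrame h (α i) (α j) (p i) (p j) c v w l m) (s : ℝ)
    (horth : ¬ Orthogonal h (p 1) (F.1.bend hh.finrank_eq s • p k)) :
    StronglyRegular h α σ τ (Function.update p k (F.1.bend hh.finrank_eq s • p k)) := by
  have := hh.finiteDimensional
  have hck := hp.apply_ne_zero hh hc F
  obtain ⟨F, hi, hj⟩ := F
  obtain ⟨a, ha, hrep⟩ := exists_rep_smul (F.bend hh.finrank_eq s) (p k)
  obtain ⟨x, hx⟩ : ∃ x, x = F.bend hh.finrank_eq s • p k := ⟨_, rfl⟩
  simp only [← hx] at horth hrep ⊢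
  have hxc : h x.rep c ≠ 0 := by
    rw [hrep, apply_smul_left, F.bend_smul, F.diagMap_coord_c, one_mul]
    exact mul_ne_zero ha hck
  have ei : Function.update p k x i = p i := Function.update_of_ne hc.ne.2.1 _ _
  have ej : Function.update p k x j = p j := Function.update_of_ne hc.ne.2.2 _ _
  have ek : Function.update p k x k = x := Function.update_self _ _ _
  refine hp.of_linearIndependent (fun y => ?_) ?_ ?_ ?_ ?_
  · by_cases hy : y = k
    · subst hy; rw [ek, hx, signature_smul]
    · rw [Function.update_of_ne hy]
  · rw [Fintype.linearIndependent_iff]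
    intro f hf
    rw [hc.sum_eq, ei, ej, ek] at hf
    have e := congrArg (fun z => h z c) hf
    simp only [map_add, LinearMap.add_apply, apply_smul_left, hi, hj, mul_zero, zero_add,
      map_zero, LinearMap.zero_apply] at e
    have hfk : f k = 0 := (mul_eq_zero.1 e).resolve_right hxc
    rw [hfk, zero_smul, add_zero] at hf
    obtain ⟨h1, h2⟩ := LinearIndependent.pair_iff.1
      (linearIndependent_rep (hp.distinct.ne hc.ne.1)) _ _ hf
    intro y
    rcases hc.eq_or y with rfl | rfl | rfl <;> assumption
  · rcases hc with ⟨rfl, rfl, rfl⟩ | ⟨rfl, rfl, rfl⟩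
    · rw [ei, ej]; exact hp.not_orthogonal_left
    · rw [ei, ek]; exact horth
  · rcases hc with ⟨rfl, rfl, rfl⟩ | ⟨rfl, rfl, rfl⟩
    · rw [ej, ek]; exact horth
    · rw [ei, ej]; exact hp.not_orthogonal_right
  · rw [hc.trace_eq, hc.trace_eq]
    refine trace_eq_of_smul (F.bend hh.finrank_eq s) fun z => ?_
    rw [pairProduct, pairProduct, ei, ej, ek, Module.End.mul_apply, F.commute_bend, hx,
      specialElliptic_smul, Module.End.mul_apply (specialElliptic h (α k) (p k))]

theorem StronglyRegular.move_bend (hh : IsHermitianSig21 h) {i j k : Fin 3}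
    (hc : IsConsecutive i j k) (hp : StronglyRegular h α σ τ p) {c v w : V} {l m : ℂ}
    (F : IsPairFrame h (α i) (α j) (p i) (p j) c v w l m) (s : ℝ)
    (horth : ¬ Orthogonal h (p 1) (F.1.bend hh.finrank_eq s • p k)) :
    Move h α σ τ p (Function.update p k (F.1.bend hh.finrank_eq s • p k)) :=
  ⟨hp, hp.update_bend hh hc F s horth, i, j, k, c, v, w, l, m, hc, F,
    Function.update_of_ne hc.ne.2.1 _ _, Function.update_of_ne hc.ne.2.2 _ _, F.1.toIsWittFrame,
    hh.finrank_eq, s, Function.update_self _ _ _⟩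

end Move

/-- The left side is continuous in `s`, at most `M` at `s = 0`, and unbounded since `A` and `C` do
not both vanish. -/
theorem exists_norm_exp_add_eq {A C : ℂ} (hAC : A + C ≠ 0) {M : ℝ} (hM : ‖A + C‖ ^ 2 ≤ M) :
    ∃ s : ℝ, ‖A * Complex.exp (-s) + C * Complex.exp s‖ ^ 2 = M := by
  wlog hC : C ≠ 0 generalizing A C
  · rw [not_not] at hC
    obtain ⟨s, hs⟩ := this (A := C) (C := A) (by rwa [add_comm]) (by rwa [add_comm C])
      (by simpa [hC] using hAC)
    refine ⟨-s, ?_⟩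
    rw [← hs]
    push_cast
    rw [neg_neg, add_comm]
  have hC0 : 0 < ‖C‖ := norm_pos_iff.2 hC
  have hM0 : 0 ≤ M := (sq_nonneg _).trans hM
  refine mem_range_of_exists_le_of_exists_ge (by fun_prop) ⟨0, by simpa using hM⟩ ?_
  -- With `s = log t` the norm is at least `‖C‖ t - ‖A‖ ≥ M + 1`, whose square exceeds `M`; the
  -- final `+ 1` gives `t ≥ 1`, so the `A`-term does not grow.
  set t := (M + 1 + ‖A‖) / ‖C‖ + 1 with ht
  have ht1 : 1 ≤ t := by
    rw [ht]
    have : 0 ≤ (M + 1 + ‖A‖) / ‖C‖ := by positivity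
    linarith
  have ht0 : 0 < t := by linarith
  have hCt : M + 1 + ‖A‖ ≤ ‖C‖ * t := by
    rw [ht, mul_add, mul_div_cancel₀ _ hC0.ne']; linarith
  refine ⟨Real.log t, ?_⟩
  have e1 : ‖C * Complex.exp (Real.log t : ℝ)‖ = ‖C‖ * t := by
    rw [norm_mul, ← Complex.ofReal_exp, Real.exp_log ht0, Complex.norm_real, Real.norm_eq_abs,
      abs_of_pos ht0]
  have e2 : ‖A * Complex.exp (-(Real.log t : ℝ))‖ ≤ ‖A‖ := by
    rw [norm_mul, ← Complex.ofReal_neg, ← Complex.ofReal_exp, Real.exp_neg, Real.exp_log ht0,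
      Complex.norm_real, Real.norm_eq_abs, abs_of_pos (inv_pos.2 ht0)]
    exact mul_le_of_le_one_right (norm_nonneg _) (inv_le_one_of_one_le₀ ht1)
  have e3 := norm_sub_norm_le (C * Complex.exp (Real.log t : ℝ))
    (-(A * Complex.exp (-(Real.log t : ℝ))))
  rw [sub_neg_eq_add, norm_neg, add_comm (C * _), e1] at e3
  nlinarith

/-! ### Changing the tance by bending; the tance as a congruence invariant. -/

section Tance

variable {h : SesqForm V}

theorem tance_eq_of_rep_right {x y : ℙ ℂ V} {a : ℂ} {z : V} (ha : a ≠ 0) (hy : y.rep = a • z) :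
    tance h x y = ‖h x.rep z‖ ^ 2 / ((h x.rep x.rep).re * (h z z).re) := by
  have ha' : ‖a‖ ^ 2 ≠ 0 := pow_ne_zero _ (norm_ne_zero_iff.2 ha)
  rw [tance, hy, apply_smul_right, apply_smul_left, apply_smul_right, ← mul_assoc,
    Complex.mul_conj', ← Complex.ofReal_pow, Complex.re_ofReal_mul, norm_mul, Complex.norm_conj,
    mul_pow, mul_left_comm]
  exact mul_div_mul_left _ _ ha'

theorem IsHermitianSig21.self_re_ne_zero (hh : IsHermitianSig21 h) {x : V} (hx : h x x ≠ 0) :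
    (h x x).re ≠ 0 := by
  rw [← hh.ofReal_re] at hx
  exact_mod_cast hx

theorem tance_ne_zero (hh : IsHermitianSig21 h) {x y : ℙ ℂ V} (hx : h x.rep x.rep ≠ 0)
    (hy : h y.rep y.rep ≠ 0) (hxy : ¬ Orthogonal h x y) : tance h x y ≠ 0 :=
  div_ne_zero (pow_ne_zero _ (norm_ne_zero_iff.2 hxy))
    (mul_ne_zero (hh.self_re_ne_zero hx) (hh.self_re_ne_zero hy))

theorem not_orthogonal_of_tance {x y : ℙ ℂ V} (hxy : tance h x y ≠ 0) : ¬ Orthogonal h x y := by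
  intro h0
  rw [Orthogonal] at h0
  rw [tance, h0] at hxy
  simp at hxy

theorem mul_nonneg_of_signature_eq {x y : ℙ ℂ V} (hxy : signature h x = signature h y) :
    0 ≤ (h x.rep x.rep).re * (h y.rep y.rep).re := by
  rw [signature, signature] at hxy
  rw [← sign_nonneg_iff, sign_mul, hxy]
  generalize SignType.sign (h y.rep y.rep).re = s
  revert s; decide

theorem tance_mul_tance_nonneg {x y x' y' : ℙ ℂ V} (hx : signature h x = signature h x')
    (hy : signature h y = signature h y') : 0 ≤ tance h x y * tance h x' y' := by
  have h1 := mul_nonneg_of_signature_eq hx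
  have h2 := mul_nonneg_of_signature_eq hy
  rw [tance, tance, div_mul_div_comm]
  refine div_nonneg (by positivity) ?_
  calc 0 ≤ _ := mul_nonneg h1 h2
    _ = _ := by ring

/-- As `x` is orthogonal to `c`, its product with the bent `y` has the form `A e^{-s} + C e^s`, with
`A + C = ⟨x, y⟩`, while the denominator of the tance stays constant. -/
theorem IsWittFrame.exists_bend_tance {c v w : V} (F : IsWittFrame h c v w)
    (hh : IsHermitianSig21 h) {x y : ℙ ℂ V} (hxc : h x.rep c = 0) (hx : h x.rep x.rep ≠ 0)
    (hy : h y.rep y.rep ≠ 0) (hxy : ¬ Orthogonal h x y) {W : ℝ} (hsign : 0 ≤ W * tance h x y)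
    (hW : |tance h x y| ≤ |W|) : ∃ s, tance h x (F.bend hh.finrank_eq s • y) = W := by
  have hV := hh.finrank_eq
  obtain ⟨K, hK⟩ : ∃ K, K = (h x.rep x.rep).re * (h y.rep y.rep).re := ⟨_, rfl⟩
  have hK0 : K ≠ 0 := by
    rw [hK]; exact mul_ne_zero (hh.self_re_ne_zero hx) (hh.self_re_ne_zero hy)
  obtain ⟨A, hA⟩ : ∃ A, A = h x.rep w * conj (h y.rep v) := ⟨_, rfl⟩
  obtain ⟨C, hC⟩ : ∃ C, C = h x.rep v * conj (h y.rep w) := ⟨_, rfl⟩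
  have hAC : A + C = h x.rep y.rep := by
    rw [F.apply_eq hV x.rep y.rep, hxc, hA, hC]; ring
  have ht : tance h x y = ‖A + C‖ ^ 2 / K := by rw [hAC, hK, tance]
  have hM : ‖A + C‖ ^ 2 ≤ W * K := by
    have h1 : 0 ≤ W * K := by
      have : W * tance h x y * K ^ 2 = W * K * ‖A + C‖ ^ 2 := by rw [ht]; field_simp
      have hpos : 0 < ‖A + C‖ ^ 2 := by
        rw [hAC]; exact pow_pos (norm_pos_iff.2 hxy) 2
      by_contra hneg
      push Not at hneg
      nlinarith [mul_nonneg hsign (sq_nonneg K), mul_pos (neg_pos.2 hneg) hpos]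
    rw [ht, abs_div, abs_of_nonneg (sq_nonneg _), div_le_iff₀ (abs_pos.2 hK0), ← abs_mul,
      abs_of_nonneg h1] at hW
    exact hW
  obtain ⟨s, hs⟩ := exists_norm_exp_add_eq (by rw [hAC]; exact hxy) hM
  refine ⟨s, ?_⟩
  obtain ⟨a, ha, hrep⟩ := exists_rep_smul (F.bend hV s) y
  have hval : h x.rep (F.bend hV s • y.rep) = A * Complex.exp (-s) + C * Complex.exp s := by
    have e1 : conj (Complex.exp (s : ℂ)) = Complex.exp s := by
      rw [← Complex.exp_conj, Complex.conj_ofReal]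
    have e2 : conj (Complex.exp (-(s : ℂ))) = Complex.exp (-s) := by
      rw [← Complex.exp_conj, map_neg, Complex.conj_ofReal]
    rw [F.apply_eq hV, hxc, F.bend_smul, F.diagMap_coord_v, F.diagMap_coord_w, map_mul, map_mul,
      e1, e2, hA, hC]
    ring
  rw [tance_eq_of_rep_right ha hrep, SU_apply, hval, hs, ← hK, mul_div_assoc, div_self hK0,
    mul_one]

theorem IsHermitianSig21.exists_scale (hh : IsHermitianSig21 h) {x y : ℙ ℂ V}
    (hx : h x.rep x.rep ≠ 0) (hxy : signature h x = signature h y) :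
    ∃ r : ℂ, r ≠ 0 ∧ h (r • y.rep) (r • y.rep) = h x.rep x.rep := by
  have hx0 := hh.self_re_ne_zero hx
  have hy0 : (h y.rep y.rep).re ≠ 0 := by
    rw [signature, signature] at hxy
    rwa [← sign_ne_zero, ← hxy, sign_ne_zero]
  have hpos : 0 < (h x.rep x.rep).re / (h y.rep y.rep).re := by
    rw [← mul_div_mul_right _ _ hy0]
    exact div_pos (lt_of_le_of_ne (mul_nonneg_of_signature_eq hxy) (mul_ne_zero hx0 hy0).symm)
      (mul_self_pos.2 hy0)
  refine ⟨(Real.sqrt ((h x.rep x.rep).re / (h y.rep y.rep).re) : ℝ), ?_, ?_⟩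
  · exact_mod_cast (Real.sqrt_pos.2 hpos).ne'
  · rw [apply_smul_left, apply_smul_right, Complex.conj_ofReal, ← mul_assoc,
      ← Complex.ofReal_mul, Real.mul_self_sqrt hpos.le]
    refine (congrArg _ (hh.ofReal_re y.rep).symm).trans ?_
    rw [← Complex.ofReal_mul, div_mul_cancel₀ _ hy0, hh.ofReal_re]

theorem linearIndependent_of_orthogonal_unit {a b c : V} (hab : LinearIndependent ℂ ![a, b])
    (ha : h a c = 0) (hb : h b c = 0) (hc : h c c = 1) : LinearIndependent ℂ ![a, b, c] := by
  rw [Fintype.linearIndependent_iff]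
  intro f hf
  simp only [Fin.sum_univ_three, Matrix.cons_val] at hf
  have e := congrArg (fun z => h z c) hf
  simp only [map_add, LinearMap.add_apply, apply_smul_left, ha, hb, hc, mul_zero, zero_add,
    mul_one, map_zero, LinearMap.zero_apply] at e
  rw [e, zero_smul, add_zero] at hf
  obtain ⟨h1, h2⟩ := LinearIndependent.pair_iff.1 hab _ _ hf
  intro i
  fin_cases i <;> assumption

/-- Pairs of points on hyperbolic lines with the same signatures and the same tance are
congruent. -/
theorem exists_SU_of_tance_eq (hh : IsHermitianSig21 h) {x y x' y' : ℙ ℂ V} {c c' : V}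
    (hxy : x ≠ y) (hxy' : x' ≠ y') (hx : h x.rep x.rep ≠ 0) (hy : h y.rep y.rep ≠ 0)
    (hsx : signature h x = signature h x') (hsy : signature h y = signature h y')
    (ho' : ¬ Orthogonal h x' y') (ht : tance h x y = tance h x' y')
    (hc : h c c = 1) (hc' : h c' c' = 1) (hxc : h x.rep c = 0) (hyc : h y.rep c = 0)
    (hxc' : h x'.rep c' = 0) (hyc' : h y'.rep c' = 0) :
    ∃ g : SU h, g • x = x' ∧ g • y = y' := by
  obtain ⟨r, hr, hrx⟩ := hh.exists_scale hx hsx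
  obtain ⟨t, ht0, hty⟩ := hh.exists_scale hy hsy
  have hne : h (r • x'.rep) (t • y'.rep) ≠ 0 := by
    rw [apply_smul_left, apply_smul_right]
    exact mul_ne_zero hr (mul_ne_zero (by simpa using ht0) ho')
  have hnorm : ‖h x.rep y.rep‖ = ‖h (r • x'.rep) (t • y'.rep)‖ := by
    have hrt : tance h x' y' = ‖h (r • x'.rep) (t • y'.rep)‖ ^ 2
        / ((h x.rep x.rep).re * (h y.rep y.rep).re) := by
      rw [← hrx, ← hty, tance]
      have aux : ∀ (a : ℂ) (z : V), (h (a • z) (a • z)).re = ‖a‖ ^ 2 * (h z z).re := by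
        intro a z
        rw [apply_smul_left, apply_smul_right, ← mul_assoc, Complex.mul_conj',
          ← Complex.ofReal_pow, Complex.re_ofReal_mul]
      have hr' : ‖r‖ ≠ 0 := norm_ne_zero_iff.2 hr
      have ht' : ‖t‖ ≠ 0 := norm_ne_zero_iff.2 ht0
      rw [aux, aux, apply_smul_left, apply_smul_right, norm_mul, norm_mul, Complex.norm_conj,
        ← mul_assoc, mul_pow, mul_pow,
        show ‖r‖ ^ 2 * (h x'.rep x'.rep).re * (‖t‖ ^ 2 * (h y'.rep y'.rep).re)
          = (‖r‖ ^ 2 * ‖t‖ ^ 2) * ((h x'.rep x'.rep).re * (h y'.rep y'.rep).re) by ring]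
      exact (mul_div_mul_left _ _ (by positivity)).symm
    rw [hrt, tance, div_left_inj' (mul_ne_zero (hh.self_re_ne_zero hx) (hh.self_re_ne_zero hy))]
      at ht
    exact (pow_left_inj₀ (norm_nonneg _) (norm_nonneg _) two_ne_zero).1 ht
  -- Equal tances leave only a phase between the products of the rescaled representatives. Absorbing
  -- it, and adding the unit normals `c`, `c'`, makes the Gram matrices equal.
  obtain ⟨u, hu⟩ : ∃ u, u = h x.rep y.rep / h (r • x'.rep) (t • y'.rep) := ⟨_, rfl⟩
  have hun : ‖u‖ = 1 := by rw [hu, norm_div, hnorm, div_self (norm_ne_zero_iff.2 hne)]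
  have hu0 : u ≠ 0 := by rintro rfl; simp at hun
  have g11 : h (u • r • x'.rep) (u • r • x'.rep) = h x.rep x.rep := by
    rw [apply_smul_left, apply_smul_right, hrx, ← mul_assoc, mul_conj_eq_one hun, one_mul]
  have g12 : h (u • r • x'.rep) (t • y'.rep) = h x.rep y.rep := by
    rw [apply_smul_left, hu, div_mul_cancel₀ _ hne]
  have g21 : h (t • y'.rep) (u • r • x'.rep) = h y.rep x.rep := by
    rw [← hh.conj_apply, g12, hh.conj_apply]
  have g13 : h (u • r • x'.rep) c' = 0 := by
    rw [apply_smul_left, apply_smul_left, hxc', mul_zero, mul_zero]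
  have g23 : h (t • y'.rep) c' = 0 := by rw [apply_smul_left, hyc', mul_zero]
  have hli' : LinearIndependent ℂ ![u • r • x'.rep, t • y'.rep] := by
    rw [LinearIndependent.pair_iff]
    intro a b hab
    obtain ⟨h1, h2⟩ := LinearIndependent.pair_iff.1 (linearIndependent_rep hxy') (a * u * r) (b * t)
      (by rw [← hab]; module)
    simpa [hu0, hr, ht0] using And.intro h1 h2
  obtain ⟨g, z, hz, hg⟩ := hh.exists_SU_of_gram
    (linearIndependent_of_orthogonal_unit (linearIndependent_rep hxy) hxc hyc hc)
    (linearIndependent_of_orthogonal_unit hli' g13 g23 hc') (by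
      intro i j
      fin_cases i <;> fin_cases j
      · exact g11.symm
      · exact g12.symm
      · exact hxc.trans g13.symm
      · exact g21.symm
      · exact hty.symm
      · exact hyc.trans g23.symm
      · exact (hh.apply_eq_zero_symm hxc).trans (hh.apply_eq_zero_symm g13).symm
      · exact (hh.apply_eq_zero_symm hyc).trans (hh.apply_eq_zero_symm g23).symm
      · exact hc.trans hc'.symm)
  refine ⟨g, smul_eq_of_rep (a := z * u * r) ?_, smul_eq_of_rep (a := z * t) ?_⟩
  · refine (hg 0).trans ?_
    simp [smul_smul, mul_assoc]
  · refine (hg 1).trans ?_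
    simp [smul_smul]

end Tance

/-! ### Centralizer orbits of a loxodromic isometry. -/

section Fibre

variable {h : SesqForm V}

/-- Multiplying by `conj l` and taking squared norms removes the phase of `n`. With `L = |l|²` this
reads `(L + 1)² Re(M)² + (L - 1)² Im(M)² = 4 L Re(M)²`, that is, `(L - 1)² |M|² = 0`. -/
theorem eq_zero_of_loxodromic_relation {n l m M : ℂ} (hn : ‖n‖ = 1) (hl : ‖l‖ ≠ 1)
    (hlm : l * conj m = 1) (hM : l * M + m * conj M = n * (M + conj M)) : M = 0 := by
  have hml : conj l * m = 1 := by
    have := congrArg conj hlm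
    rwa [map_mul, Complex.conj_conj, map_one] at this
  have e1 : ((‖l‖ ^ 2 : ℝ) : ℂ) * M + conj M = conj l * n * (M + conj M) := by
    push_cast
    rw [← Complex.conj_mul']
    linear_combination conj l * hM - conj M * hml
  have e2 := congrArg (fun z => ‖z‖ ^ 2) e1
  simp only [norm_mul, Complex.norm_conj, hn, mul_one, mul_pow, Complex.add_conj,
    Complex.norm_real, Real.norm_eq_abs, sq_abs] at e2
  rw [← Complex.normSq_eq_norm_sq, Complex.normSq_apply] at e2
  simp only [Complex.add_re, Complex.add_im, Complex.re_ofReal_mul, Complex.im_ofReal_mul,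
    Complex.conj_re, Complex.conj_im] at e2
  have hL : ‖l‖ ^ 2 - 1 ≠ 0 := by
    rw [sub_ne_zero]
    exact fun h1 => hl ((pow_eq_one_iff_of_nonneg (norm_nonneg _) two_ne_zero).1 h1)
  have e3 : (‖l‖ ^ 2 - 1) ^ 2 * (M.re ^ 2 + M.im ^ 2) = 0 := by linear_combination e2
  have e4 := (mul_eq_zero.1 e3).resolve_left (pow_ne_zero 2 hL)
  apply Complex.ext
  · simp only [Complex.zero_re]; nlinarith [sq_nonneg M.re, sq_nonneg M.im]
  · simp only [Complex.zero_im]; nlinarith [sq_nonneg M.re, sq_nonneg M.im]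

/-- Negative vectors with the same values of `⟨x, x⟩` and `⟨R x, x⟩` lie on the same orbit of the
centralizer of the loxodromic isometry `R`. -/
theorem IsLoxFrame.exists_diagMap_eq {R : End ℂ V} {c v w : V} {n l m : ℂ}
    (F : IsLoxFrame h R c v w n l m) (hV : finrank ℂ V = 3) {x y : V} (hxy : h x x = h y y)
    (hneg : (h x x).re < 0) (hxc : h x c ≠ 0) (hR : h (R x) x = h (R y) y) :
    ∃ (s : ℝ) (e z : ℂ), ‖e‖ = 1 ∧ z ≠ 0 ∧
      y = z • diagMap h c v w e (Complex.exp s) (Complex.exp (-s)) x := by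
  rw [F.apply_eq_diagMap hV, F.apply_eq_diagMap hV, F.apply_eq hV, F.apply_eq hV _ y] at hR
  simp only [F.diagMap_coord_c, F.diagMap_coord_v, F.diagMap_coord_w] at hR
  rw [F.apply_eq hV x x, F.apply_eq hV y y] at hxy
  rw [F.apply_eq hV x x] at hneg
  have ey := F.expand hV y
  simp only [diagMap_apply]
  generalize h x c = x₀ at *
  generalize h x w = x₁ at *
  generalize h x v = x₂ at *
  generalize h y c = y₀ at *
  generalize h y w = y₁ at *
  generalize h y v = y₂ at *
  -- Eliminating the `c`-coordinates between the two given equalities leaves the relation of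
  -- `eq_zero_of_loxodromic_relation` for this difference.
  have hM : x₁ * conj x₂ - y₁ * conj y₂ = 0 := by
    refine eq_zero_of_loxodromic_relation F.norm_n F.norm_l F.mul_conj ?_
    simp only [map_sub, map_mul, Complex.conj_conj]
    linear_combination hR - n * hxy
  have hM' : conj x₁ * x₂ - conj y₁ * y₂ = 0 := by
    have := congrArg conj hM
    simpa using this
  have h0 : x₀ * conj x₀ = y₀ * conj y₀ := by linear_combination hxy - hM - hM'
  -- Negativity enters here: without an isotropic coordinate, `⟨x, x⟩ = |x₀|² ≥ 0`.
  have hx₁ : x₁ ≠ 0 := by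
    rintro rfl
    simp only [map_zero, zero_mul, mul_zero, add_zero, Complex.mul_conj, Complex.ofReal_re] at hneg
    exact absurd (Complex.normSq_nonneg x₀) (not_le.2 hneg)
  have hx₂ : x₂ ≠ 0 := by
    rintro rfl
    simp only [map_zero, zero_mul, mul_zero, add_zero, Complex.mul_conj, Complex.ofReal_re] at hneg
    exact absurd (Complex.normSq_nonneg x₀) (not_le.2 hneg)
  have hy₁ : y₁ ≠ 0 := by
    rintro rfl
    rw [zero_mul, sub_zero] at hM
    exact (mul_ne_zero hx₁ (by simpa using hx₂)) hM
  have hn0 : ‖y₀‖ = ‖x₀‖ := by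
    rw [Complex.mul_conj', Complex.mul_conj'] at h0
    have : ‖x₀‖ ^ 2 = ‖y₀‖ ^ 2 := by exact_mod_cast h0
    exact ((pow_left_inj₀ (norm_nonneg _) (norm_nonneg _) two_ne_zero).1 this).symm
  have hx₁n := norm_pos_iff.2 hx₁
  have hy₁n := norm_pos_iff.2 hy₁
  -- `s` matches the moduli of the `v`-components and `z` their phases; the equality of `x₁ * conj
  -- x₂` with `y₁ * conj y₂` then matches the `w`-components.
  obtain ⟨s, hs⟩ : ∃ s : ℝ, Real.exp s = ‖y₁‖ / ‖x₁‖ := ⟨_, Real.exp_log (div_pos hy₁n hx₁n)⟩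
  obtain ⟨E, hE⟩ : ∃ E : ℂ, E = Complex.exp s := ⟨_, rfl⟩
  have hE0 : E ≠ 0 := hE ▸ Complex.exp_ne_zero _
  have hEr : conj E = E := by rw [hE, ← Complex.exp_conj, Complex.conj_ofReal]
  have hEn : ‖E‖ = ‖y₁‖ / ‖x₁‖ := by
    rw [hE, ← Complex.ofReal_exp, Complex.norm_real, Real.norm_eq_abs, Real.abs_exp, hs]
  obtain ⟨z, hz⟩ : ∃ z, z = y₁ / (E * x₁) := ⟨_, rfl⟩
  have hzn : ‖z‖ = 1 := by
    rw [hz, norm_div, norm_mul, hEn, div_mul_cancel₀ _ hx₁n.ne', div_self hy₁n.ne']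
  have hz0 : z ≠ 0 := by rintro rfl; simp at hzn
  have hzz := mul_conj_eq_one hzn
  have e1 : y₁ = z * (E * x₁) := by
    rw [hz, div_mul_cancel₀ _ (mul_ne_zero hE0 hx₁)]
  have e2 : y₂ = z * (E⁻¹ * x₂) := by
    have hcx : conj x₁ ≠ 0 := by simpa using hx₁
    have hcz : conj z ≠ 0 := by simpa using hz0
    rw [e1, map_mul, map_mul, hEr] at hM'
    have h3 : conj z * E * y₂ = x₂ :=
      mul_left_cancel₀ hcx (by linear_combination -hM')
    rw [← h3]
    field_simp
    linear_combination -y₂ * hzz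
  refine ⟨s, y₀ / (z * x₀), z, ?_, hz0, ?_⟩
  · rw [norm_div, norm_mul, hzn, hn0, one_mul, div_self (norm_ne_zero_iff.2 hxc)]
  · rw [Complex.exp_neg, ← hE]
    conv_lhs => rw [ey, e1, e2]
    rw [smul_add, smul_add, smul_smul, smul_smul, smul_smul]
    congr 3
    field_simp

end Fibre

/-! ### Connecting two strongly regular triples. -/

section Connect

variable {h : SesqForm V} {α : Fin 3 → ℂ} {σ : Fin 3 → SignType} {τ : ℂ} {p q : Fin 3 → ℙ ℂ V}

theorem parameter_ne_zero {a : ℂ} (ha : ‖a‖ = 1) (ha3 : a ^ 3 ≠ 1) : (a ^ 2)⁻¹ - a ≠ 0 := by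
  have ha0 : a ≠ 0 := by rintro rfl; simp at ha
  intro h0
  apply ha3
  have : a ^ 2 * ((a ^ 2)⁻¹ - a) = 0 := by rw [h0, mul_zero]
  rw [mul_sub, mul_inv_cancel₀ (pow_ne_zero 2 ha0)] at this
  linear_combination -this

/-- In a fibre with a fixed loxodromic pair and a negative third point, any two strongly regular
triples are related by a bending and an element of `SU(2,1)`. -/
theorem connected_of_eq_pair (hh : IsHermitianSig21 h) {i j k : Fin 3}
    (hc : IsConsecutive i j k) (hp : StronglyRegular h α σ τ p) (hq : StronglyRegular h α σ τ q)
    {c v w : V} {l m : ℂ} (F : IsPairFrame h (α i) (α j) (p i) (p j) c v w l m)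
    (hi : q i = p i) (hj : q j = p j) (hk : σ k = -1) :
    Relation.ReflTransGen (MoveOrTranslate h α σ τ) p q := by
  have := hh.finiteDimensional
  have hV := hh.finrank_eq
  have hpk := hp.self_ne_zero hh k
  have hqk := hq.self_ne_zero hh k
  obtain ⟨r, hr, hrr⟩ := hh.exists_scale hpk ((hp.signature_eq k).trans (hq.signature_eq k).symm)
  have hneg : (h (p k).rep (p k).rep).re < 0 := by
    have := hp.signature_eq k
    rwa [hk, signature, sign_eq_neg_one_iff] at this
  obtain ⟨R, hR⟩ : ∃ R, R = specialElliptic h (α j) (p j) * specialElliptic h (α i) (p i) :=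
    ⟨_, rfl⟩
  -- Both triples have trace `τ` and the same `R`, so after scaling to equal squares the remaining
  -- term of `trace_specialElliptic_mul` must agree.
  have hRr : h (R (p k).rep) (p k).rep = h (R (r • (q k).rep)) (r • (q k).rep) := by
    have htr := hp.trace_eq.trans hq.trace_eq.symm
    rw [hc.trace_eq, hc.trace_eq, pairProduct, pairProduct, hi, hj, ← hR,
      trace_specialElliptic_mul, trace_specialElliptic_mul, add_left_inj] at htr
    have hβ := parameter_ne_zero (hp.norm_param k) (hp.param_cube k)
    rw [apply_smul_left, apply_smul_right] at hrr
    rw [map_smul R, apply_smul_left, apply_smul_right]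
    rw [← hrr] at htr hpk
    have hcr : conj r ≠ 0 := by simpa using hr
    generalize (α k ^ 2)⁻¹ - α k = β at htr hβ
    field_simp at htr
    linear_combination htr
  have F' := F.toIsLoxFrame
  rw [← hR] at F'
  obtain ⟨s, e, z, he, hz, hey⟩ := F'.exists_diagMap_eq hV hrr.symm hneg
    (hp.apply_ne_zero hh hc F) hRr
  have he0 : e ≠ 0 := by rintro rfl; simp at he
  -- The factor `e` of the orbit map rotates about the line of the pair. It fixes both centres, so
  -- it can be split off from the bending as a translation.
  obtain ⟨g, u, hu, hg⟩ := hh.exists_SU_of_isometry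
    (F.diagEquiv hV he0 one_ne_zero one_ne_zero)
    (F.diagMap_isometry hV (mul_conj_eq_one he) (by simp))
  replace hg : ∀ x : V, g • x = u • diagMap h c v w e 1 1 x := hg
  have hfix : ∀ {x : ℙ ℂ V}, h x.rep c = 0 → g • x = x := by
    intro x hx
    refine smul_eq_of_rep (a := u) ?_
    rw [hg, diagMap_apply, hx, mul_zero, zero_smul, zero_add, one_mul, one_mul]
    conv_rhs => rw [F.expand hV x.rep, hx, zero_smul, zero_add]
  have hgk : g • F.bend hV s • p k = q k := by
    rw [← mul_smul]
    refine smul_eq_of_rep (a := u * z⁻¹ * r) ?_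
    rw [mul_smul, hg, F.bend_smul, F.diagMap_diagMap, mul_one, one_mul, one_mul, mul_smul (u * z⁻¹),
      hey, smul_smul, mul_assoc, inv_mul_cancel₀ hz, mul_one]
  obtain ⟨p', hp'⟩ : ∃ p', p' = Function.update p k (F.bend hV s • p k) := ⟨_, rfl⟩
  have ei : p' i = p i := by rw [hp']; exact Function.update_of_ne hc.ne.2.1 _ _
  have ej : p' j = p j := by rw [hp']; exact Function.update_of_ne hc.ne.2.2 _ _
  have ek : p' k = F.bend hV s • p k := by rw [hp']; exact Function.update_self _ _ _
  have hgq : ∀ x, q x = g • p' x := by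
    intro x
    rcases hc.eq_or x with rfl | rfl | rfl
    · rw [ei, hi, hfix F.left_orthogonal]
    · rw [ej, hj, hfix F.right_orthogonal]
    · rw [ek, hgk]
  have hsr : StronglyRegular h α σ τ p' := by
    -- The bent triple is a translate of `q`, so its regularity, including nonorthogonality, is
    -- inherited from `q`.
    have : p' = fun x => g⁻¹ • q x := funext fun x => by rw [hgq, inv_smul_smul]
    rw [this]
    exact hq.smul hh _
  have hmove : Move h α σ τ p p' :=
    ⟨hp, hsr, i, j, k, c, v, w, l, m, hc, F, ei, ej, F.toIsWittFrame, hV, s, ek⟩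
  exact (Relation.ReflTransGen.single hmove.moveOrTranslate).tail (moveOrTranslate_of_smul hgq)

theorem IsConsecutive.eq_one {i j k : Fin 3} (hc : IsConsecutive i j k) : 1 = i ∨ 1 = j := by
  rcases hc with ⟨rfl, rfl, rfl⟩ | ⟨rfl, rfl, rfl⟩ <;> simp

theorem StronglyRegular.not_orthogonal (hp : StronglyRegular h α σ τ p) {i j k : Fin 3}
    (hc : IsConsecutive i j k) : ¬ Orthogonal h (p 1) (p k) := by
  rcases hc with ⟨rfl, rfl, rfl⟩ | ⟨rfl, rfl, rfl⟩
  · exact hp.not_orthogonal_right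
  · exact hp.not_orthogonal_left

theorem StronglyRegular.tance_ne_zero (hh : IsHermitianSig21 h) (hp : StronglyRegular h α σ τ p)
    {i j k : Fin 3} (hc : IsConsecutive i j k) : tance h (p 1) (p k) ≠ 0 :=
  ComplexHyperbolic.tance_ne_zero hh (hp.self_ne_zero hh 1) (hp.self_ne_zero hh k)
    (hp.not_orthogonal hc)

/-- The target `W` is nonzero because the initial tance is, and a nonzero tance excludes the one way
in which bending could destroy strong regularity. -/
theorem StronglyRegular.exists_move_tance (hh : IsHermitianSig21 h)
    (hp : StronglyRegular h α σ τ p) {i j k : Fin 3} (hc : IsConsecutive i j k)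
    {c v w : V} {l m : ℂ} (F : IsPairFrame h (α i) (α j) (p i) (p j) c v w l m)
    {W : ℝ} (hsign : 0 ≤ W * tance h (p 1) (p k)) (hW : |tance h (p 1) (p k)| ≤ |W|) :
    ∃ p', Move h α σ τ p p' ∧ p' i = p i ∧ p' j = p j ∧ tance h (p' 1) (p' k) = W := by
  have h1c : h (p 1).rep c = 0 := by
    rcases hc.eq_one with h1 | h1 <;> rw [h1]
    · exact F.left_orthogonal
    · exact F.right_orthogonal
  obtain ⟨s, hs⟩ := F.exists_bend_tance hh h1c (hp.self_ne_zero hh 1) (hp.self_ne_zero hh k)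
    (hp.not_orthogonal hc) hsign hW
  have hW0 : W ≠ 0 := by
    rintro rfl
    rw [abs_zero] at hW
    exact hp.tance_ne_zero hh hc (abs_nonpos_iff.1 hW)
  have h1k : (1 : Fin 3) ≠ k := by
    rcases hc.eq_one with h1 | h1 <;> rw [h1]
    · exact hc.ne.2.1
    · exact hc.ne.2.2
  refine ⟨_, hp.move_bend hh hc F s (not_orthogonal_of_tance (hs.trans_ne hW0)),
    Function.update_of_ne hc.ne.2.1 _ _, Function.update_of_ne hc.ne.2.2 _ _, ?_⟩
  rw [Function.update_self, Function.update_of_ne h1k]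
  exact hs

/-- The two consecutive pairs share the middle point, so the tance changed by bending one pair is
that of the other pair. -/
theorem IsConsecutive.tance_eq (hh : IsHermitianSig21 h) {i j k i' j' k' : Fin 3}
    (hc : IsConsecutive i j k) (hc' : IsConsecutive i' j' k') (hk : k ≠ k')
    (p : Fin 3 → ℙ ℂ V) : tance h (p 1) (p k') = tance h (p i) (p j) := by
  rcases hc with ⟨rfl, rfl, rfl⟩ | ⟨rfl, rfl, rfl⟩ <;>
    rcases hc' with ⟨rfl, rfl, rfl⟩ | ⟨rfl, rfl, rfl⟩
  · exact absurd rfl hk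
  · exact tance_comm hh _ _
  · rfl
  · exact absurd rfl hk

theorem StronglyRegular.exists_pairFrame (hh : IsHermitianSig21 h)
    (hp : StronglyRegular h α σ τ p) {i j : Fin 3} (hij : i ≠ j)
    (hbig : 4 < ‖(α i ^ 2)⁻¹ - α i‖ * ‖(α j ^ 2)⁻¹ - α j‖ * |tance h (p i) (p j)|) :
    ∃ c v w l m, IsPairFrame h (α i) (α j) (p i) (p j) c v w l m :=
  exists_pairFrame_of_tance hh (hp.norm_param i) (hp.norm_param j) (hp.self_ne_zero hh i)
    (hp.self_ne_zero hh j) (hp.distinct.ne hij) hbig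

theorem StronglyRegular.exists_pairFrame_of_isLoxodromic (hh : IsHermitianSig21 h)
    (hp : StronglyRegular h α σ τ p) {i j : Fin 3}
    (hlox : IsLoxodromic h (pairProduct h α p i j)) :
    ∃ c v w l m, IsPairFrame h (α i) (α j) (p i) (p j) c v w l m :=
  ComplexHyperbolic.exists_pairFrame_of_isLoxodromic hh (hp.norm_param i) (hp.norm_param j)
    (hp.self_ne_zero hh i) (hp.self_ne_zero hh j) hlox

/-- Starting from a triple with a loxodromic pair, the tance of either pair takes all values of the
right sign that are large enough. -/
theorem StronglyRegular.exists_tance_eq (hh : IsHermitianSig21 h)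
    (hp : StronglyRegular h α σ τ p) {i j k i' j' k' : Fin 3}
    (hc : IsConsecutive i j k) (hc' : IsConsecutive i' j' k') (hk : k ≠ k')
    (hlox : IsLoxodromic h (pairProduct h α p i j) ∨ IsLoxodromic h (pairProduct h α p i' j'))
    {W : ℝ} (hsign : 0 ≤ W * tance h (p i) (p j)) (hW : |tance h (p i) (p j)| ≤ |W|) :
    ∃ p', Relation.ReflTransGen (MoveOrTranslate h α σ τ) p p' ∧ StronglyRegular h α σ τ p' ∧
      tance h (p' i) (p' j) = W := by
  have key : ∀ {r : Fin 3 → ℙ ℂ V}, StronglyRegular h α σ τ r → r i = p i → r j = p j →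
      (∃ c v w l m, IsPairFrame h (α i') (α j') (r i') (r j') c v w l m) →
      ∃ p', Move h α σ τ r p' ∧ tance h (p' i) (p' j) = W := by
    rintro r hr hi hj ⟨c, v, w, l, m, F⟩
    have e := hc.tance_eq hh hc' hk
    obtain ⟨p', hm, -, -, ht⟩ := hr.exists_move_tance hh hc' F (W := W)
      (by rwa [e, hi, hj]) (by rwa [e, hi, hj])
    exact ⟨p', hm, by rwa [← e]⟩
  rcases hlox with hlox | hlox
  · obtain ⟨c, v, w, l, m, F⟩ := hp.exists_pairFrame_of_isLoxodromic hh hlox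
    obtain ⟨t, ht⟩ : ∃ t, t = tance h (p 1) (p k) := ⟨_, rfl⟩
    have ht0 : 0 < |t| := abs_pos.2 (ht ▸ hp.tance_ne_zero hh hc)
    obtain ⟨b, hb⟩ : ∃ b, b = ‖(α i' ^ 2)⁻¹ - α i'‖ * ‖(α j' ^ 2)⁻¹ - α j'‖ := ⟨_, rfl⟩
    have hb0 : 0 < b := by
      rw [hb]
      exact mul_pos (norm_pos_iff.2 (parameter_ne_zero (hp.norm_param _) (hp.param_cube _)))
        (norm_pos_iff.2 (parameter_ne_zero (hp.norm_param _) (hp.param_cube _)))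
    -- Scaling by this factor turns `b * |t|` into `b * |t| + 5 > 4`, which makes the other pair
    -- loxodromic while `p i` and `p j` stay in place.
    have hf : 0 < 1 + 5 / (b * |t|) := by positivity
    obtain ⟨r, hm, hi, hj, hr⟩ := hp.exists_move_tance hh hc F (W := (1 + 5 / (b * |t|)) * t)
      (by rw [← ht, mul_assoc]; exact mul_nonneg hf.le (mul_self_nonneg t))
      (by
        rw [← ht, abs_mul, abs_of_pos hf]
        have : 0 ≤ 5 / (b * |t|) := by positivity
        nlinarith)
    obtain ⟨p', hm', hp'⟩ := key hm.2.1 hi hj (hm.2.1.exists_pairFrame hh hc'.ne.1 (by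
      rw [← hb, ← hc'.tance_eq hh hc hk.symm, hr, abs_mul, abs_of_pos hf]
      have : b * ((1 + 5 / (b * |t|)) * |t|) = b * |t| + 5 := by field_simp
      rw [this]
      nlinarith [mul_pos hb0 ht0]))
    exact ⟨p', (Relation.ReflTransGen.single hm.moveOrTranslate).tail hm'.moveOrTranslate,
      hm'.2.1, hp'⟩
  · obtain ⟨p', hm, hp'⟩ := key hp rfl rfl (hp.exists_pairFrame_of_isLoxodromic hh hlox)
    exact ⟨p', .single hm.moveOrTranslate, hm.2.1, hp'⟩

theorem connected_of_isLoxodromic (hh : IsHermitianSig21 h) (hp : StronglyRegular h α σ τ p)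
    (hq : StronglyRegular h α σ τ q) {i j k i' j' k' : Fin 3}
    (hc : IsConsecutive i j k) (hc' : IsConsecutive i' j' k') (hk : k ≠ k') (hσ : σ k = -1)
    (hplox : IsLoxodromic h (pairProduct h α p i j) ∨ IsLoxodromic h (pairProduct h α p i' j'))
    (hqlox : IsLoxodromic h (pairProduct h α q i j) ∨ IsLoxodromic h (pairProduct h α q i' j')) :
    Relation.ReflTransGen (MoveOrTranslate h α σ τ) p q := by
  have e := hc.tance_eq hh hc' hk
  obtain ⟨t, ht⟩ : ∃ t, t = tance h (p i) (p j) := ⟨_, rfl⟩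
  obtain ⟨t', ht'⟩ : ∃ t', t' = tance h (q i) (q j) := ⟨_, rfl⟩
  have ht0 : 0 < |t| := abs_pos.2 (by rw [ht, ← e]; exact hp.tance_ne_zero hh hc')
  have htt : 0 ≤ t * t' := by
    rw [ht, ht']
    exact tance_mul_tance_nonneg ((hp.signature_eq i).trans (hq.signature_eq i).symm)
      ((hp.signature_eq j).trans (hq.signature_eq j).symm)
  obtain ⟨b, hb⟩ : ∃ b, b = ‖(α i ^ 2)⁻¹ - α i‖ * ‖(α j ^ 2)⁻¹ - α j‖ := ⟨_, rfl⟩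
  have hb0 : 0 < b := by
    rw [hb]
    exact mul_pos (norm_pos_iff.2 (parameter_ne_zero (hp.norm_param _) (hp.param_cube _)))
      (norm_pos_iff.2 (parameter_ne_zero (hp.norm_param _) (hp.param_cube _)))
  -- The common target `K * t` must exceed both tances in absolute value, so that both triples can
  -- reach it, and `4 / b`, so that the pairs become loxodromic. It has the right sign for `q`,
  -- since the sign of a tance depends only on the signatures.
  obtain ⟨K, hK⟩ : ∃ K, K = (|t| + |t'| + 5 / b) / |t| := ⟨_, rfl⟩
  have hK0 : 0 < K := by rw [hK]; positivity
  have hKt : |K * t| = |t| + |t'| + 5 / b := by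
    rw [abs_mul, abs_of_pos hK0, hK, div_mul_cancel₀ _ ht0.ne']
  have h5 : 0 < 5 / b := by positivity
  have hbig : 4 < b * |K * t| := by
    have : b * |K * t| = b * |t| + b * |t'| + 5 := by rw [hKt]; field_simp
    rw [this]
    nlinarith [mul_pos hb0 ht0, mul_nonneg hb0.le (abs_nonneg t')]
  obtain ⟨p', hpp', hp', htp⟩ := hp.exists_tance_eq hh hc hc' hk hplox (W := K * t)
    (by rw [← ht, mul_assoc]; exact mul_nonneg hK0.le (mul_self_nonneg t))
    (by rw [← ht, hKt]; linarith [abs_nonneg t'])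
  obtain ⟨q', hqq', hq', htq⟩ := hq.exists_tance_eq hh hc hc' hk hqlox (W := K * t)
    (by rw [← ht', mul_assoc]; exact mul_nonneg hK0.le htt)
    (by rw [← ht', hKt]; linarith)
  obtain ⟨c, v, w, l, m, F⟩ := hp'.exists_pairFrame hh hc.ne.1 (by rwa [htp, ← hb])
  obtain ⟨c', v', w', l', m', F'⟩ := hq'.exists_pairFrame hh hc.ne.1 (by rwa [htq, ← hb])
  have horth : ¬ Orthogonal h (q' i) (q' j) := by
    refine not_orthogonal_of_tance ?_
    rw [← e]
    exact hq'.tance_ne_zero hh hc'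
  obtain ⟨g, hgi, hgj⟩ := exists_SU_of_tance_eq hh (hp'.distinct.ne hc.ne.1)
    (hq'.distinct.ne hc.ne.1) (hp'.self_ne_zero hh i) (hp'.self_ne_zero hh j)
    ((hp'.signature_eq i).trans (hq'.signature_eq i).symm)
    ((hp'.signature_eq j).trans (hq'.signature_eq j).symm) horth (htp.trans htq.symm)
    F.cc F'.cc F.left_orthogonal F.right_orthogonal F'.left_orthogonal F'.right_orthogonal
  have hmeet := connected_of_eq_pair hh hc (hp'.smul hh g) hq' (F.smul g) hgi.symm hgj.symm hσ
  exact ((hpp'.tail (moveOrTranslate_of_smul fun _ => rfl)).trans hmeet).trans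
    (Std.Symm.symm _ _ hqq')

end Connect

end ComplexHyperbolic


theorem mainTheorem8 {V : Type*} [AddCommGroup V] [Module ℂ V]
    (h : SesqForm V) (hh : IsHermitianSig21 h)
    (α : Fin 3 → ℂ) (σ : Fin 3 → SignType) (τ : ℂ)
    (p q : Fin 3 → Projectivization ℂ V)
    (hp : StronglyRegular h α σ τ p) (hq : StronglyRegular h α σ τ q)
    (hconj : SUConj h (tripleProduct h α p) (tripleProduct h α q))
    (hploxo : IsLoxodromic h (pairProduct h α p 1 2) ∨ IsLoxodromic h (pairProduct h α p 0 1))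
    (hqloxo : IsLoxodromic h (pairProduct h α q 1 2) ∨ IsLoxodromic h (pairProduct h α q 0 1)) :
    ∃ r : Fin 3 → Projectivization ℂ V,
      Relation.ReflTransGen (BendingStep h α σ τ) p r ∧
        ∃ g : SU h, ∀ i, r i = g • q i := by
  have h12 : IsConsecutive 1 2 0 := Or.inr ⟨rfl, rfl, rfl⟩
  have h01 : IsConsecutive 0 1 2 := Or.inl ⟨rfl, rfl, rfl⟩
  have hneg : ∀ i, σ i ≠ 1 → σ i = -1 := by
    intro i hi
    have h0 := hp.sign_ne_zero i
    revert hi h0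
    generalize σ i = s
    revert s
    decide
  refine exists_bendingSteps hh ?_
  -- The third point of the final comparison must be negative: the last point if the first one is
  -- positive, and the first one otherwise.
  by_cases hσ : σ 0 = 1
  · have hσ2 : σ 2 = -1 := hneg 2 fun h2 =>
      absurd (hp.at_most_one_positive 0 2 hσ h2) (by decide)
    exact connected_of_isLoxodromic hh hp hq h01 h12 (by decide) hσ2 hploxo.symm hqloxo.symm
  · exact connected_of_isLoxodromic hh hp hq h12 h01 (by decide) (hneg 0 hσ) hploxo hqloxo
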